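/- Let $S=\mathbb{C}[x,y,z,w]$ and let $D: f=0$ be a reduced surface of degree $d$ in $\mathbb{P}^3$, with $f\in S$ homogeneous. Let $J_f$ be the ideal spanned by the partial derivatives $f_x,f_y,f_z,f_w$, let $M(f)=S/J_f$, and let $\Sigma\subset\mathbb{P}^3$ be the singular subscheme defined by $J_f$. Let $$AR(f)=\{(\alpha,\beta,\gamma,\delta)\in S^4 : \alpha f_x+\beta f_y+\gamma f_z+\delta f_w=0\}$$ be the graded module of Jacobian syzygies; a syzygy has degree $q$ if its components are homogeneous of degree $q$. Assume that $D$ is not a cone, i.e. $AR(f)$ has no nonzero element of degree $0$, and that $\dim\Sigma=1$. Then the Hilbert polynomial of $M(f)$ has the form $ak+b$, and $\deg\Sigma=a$. The surface $D$ is *free* if $AR(f)$ has an $S$-basis of three homogeneous syzygies, of positive degrees. It is *nearly free with exponents* $1\le d_1\le d_2\le d_3$ if $d_1+d_2+d_3=d$ and $AR(f)$ has a minimal system of generators consisting of four homogeneous syzygies of degrees $d_1,d_2,d_3,d_3$. Let $\rho_1\in AR(f)$ be a nonzero homogeneous syzygy of minimal degree $e_1$, and let $\rho_2\in AR(f)$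 be a homogeneous syzygy of degree $e_2$ representing a nonzero homogeneous element of minimal degree in $AR(f)/S\rho_1$; so $e_1\le e_2$. For $\rho=(\alpha,\beta,\gamma,\delta)$ put $\omega(\rho)=\alpha\,dx+\beta\,dy+\gamma\,dz+\delta\,dw$. Then $D$ is *tame with respect to* $\rho_1,\rho_2$ if every $\rho\in AR(f)$ with $\omega(\rho_1)\wedge\omega(\rho_2)\wedge\omega(\rho)=0$ lies in $S\rho_1+S\rho_2$. **Corollary.** Let $D$ be as above, tame with respect to the pair $\rho_1,\rho_2$. Set $e_3=d-1-e_1-e_2$, assume $e_3\ge e_2$ and that $D$ is not free, and put $s_1=e_1+e_2+e_3$, $s_2=e_1e_2+e_1e_3+e_2e_3$. Then $$\deg\Sigma\le s_1^2-s_2-1,$$ and equality holds if $D$ is nearly free with exponents $e_1,e_2,e_3+1$. Conversely, if equality holds and $AR(f)$ is generated by $\rho_1,\rho_2$ and two other syzygies $\rho_3,\rho_4\in AR(f)$, then $D$ is nearly free with exponents $e_1,e_2,e_3+1$. -/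

import Mathlib

open MvPolynomial

namespace ProjSurface

noncomputable section

/-- The graded polynomial ring `S = ℂ[x, y, z, w]`, the variables being indexed by `Fin 4`. -/
abbrev S : Type := MvPolynomial (Fin 4) ℂ

/-- The Jacobian ideal `J_f`, spanned by the first order partial derivatives of `f`. -/
def jacobianIdeal (f : S) : Ideal S := Ideal.span (Set.range fun i : Fin 4 => pderiv i f)

/-- The Milnor (Jacobian) algebra `M(f) = S / J_f`. -/
abbrev MilnorAlgebra (f : S) : Type := S ⧸ jacobianIdeal f

/-- The graded piece `M(f)_k`, the image of `S_k` in `M(f)`. -/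
def milnorPiece (f : S) (k : ℕ) : Submodule ℂ (MilnorAlgebra f) :=
  (homogeneousSubmodule (Fin 4) ℂ k).map (Ideal.Quotient.mkₐ ℂ (jacobianIdeal f)).toLinearMap

/-- The Hilbert function `k ↦ m(f)_k = dim M(f)_k`. -/
def milnorDim (f : S) (k : ℕ) : ℕ := Module.finrank ℂ (milnorPiece f k)

/-- `P` is the Hilbert polynomial of `M(f)`: `P(k) = dim M(f)_k` for all large `k`. -/
def IsHilbertPolynomial (f : S) (P : Polynomial ℚ) : Prop :=
  ∀ᶠ k : ℕ in Filter.atTop, P.eval (k : ℚ) = (milnorDim f k : ℚ)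

open Classical in
/-- The Hilbert polynomial `P(M(f))`. It exists by Hilbert's theorem and is unique, since two
polynomials with the same values at all large integers agree; the value `0` of the second branch
is therefore never used. -/
def hilbertPolynomial (f : S) : Polynomial ℚ :=
  if h : ∃ P, IsHilbertPolynomial f P then h.choose else 0

attribute [local instance] MvPolynomial.gradedAlgebra in
/-- The dimension of the singular subscheme `Σ ⊆ ℙ³ = Proj S` defined by `J_f`: the dimension of
its underlying space, the closed set of homogeneous primes containing `J_f`
(`⊥` if `Σ` is empty). -/
def singDim (f : S) : WithBot ℕ∞ :=
  topologicalKrullDim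
    (ProjectiveSpectrum.zeroLocus (homogeneousSubmodule (Fin 4) ℂ) (jacobianIdeal f : Set S))

/-- The degree of the nonempty scheme `Σ`: if `m = dim Σ`, then `P(M(f))` has degree `m`, and
`deg Σ = m! * a` where `a` is its leading coefficient, i.e. the coefficient of `k ^ m`. -/
def singDegree (f : S) : ℚ :=
  let m : ℕ := ((singDim f).unbotD 0).toNat
  (m.factorial : ℚ) * (hilbertPolynomial f).coeff m

/-- The `S`-module `AR(f) ⊆ S⁴` of all Jacobian syzygies: the `ρ` with `∑ i, ρ i * f_i = 0`. -/
def AR (f : S) : Submodule S (Fin 4 → S) :=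
  LinearMap.ker (Fintype.linearCombination S fun i : Fin 4 => pderiv i f)

/-- `ρ ∈ S⁴` is homogeneous of degree `q`: all its components lie in `S_q`. -/
def IsHomogeneousVec (ρ : Fin 4 → S) (q : ℕ) : Prop := ∀ i, (ρ i).IsHomogeneous q

/-- `mdr(f)`, the minimal degree of a nontrivial homogeneous Jacobian relation. -/
def mdr (f : S) : ℕ := sInf {q | ∃ ρ ∈ AR f, ρ ≠ 0 ∧ IsHomogeneousVec ρ q}

/-- The surface `f = 0` is a free divisor: the graded module `AR(f)` is isomorphic to
`S(-d₁) ⊕ S(-d₂) ⊕ S(-d₃)` for some positive integers `d₁ ≤ d₂ ≤ d₃`, i.e. it has a basis of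
homogeneous syzygies of these degrees. -/
def IsFreeDivisor (f : S) : Prop :=
  ∃ d : Fin 3 → ℕ, Monotone d ∧ (∀ j, 0 < d j) ∧
    ∃ b : Module.Basis (Fin 3) S (AR f), ∀ j, IsHomogeneousVec (b j : Fin 4 → S) (d j)

/-- The surface `f = 0` of degree `d` is a nearly free divisor with exponents `d₁ ≤ d₂ ≤ d₃`:
four homogeneous syzygies of degrees `d₁, d₂, d₃, d₃`, where `d₃ = d - (d₁ + d₂)`, form a minimal
system of generators of `AR(f)`. -/
def IsNearlyFreeWith (f : S) (d d₁ d₂ d₃ : ℕ) : Prop :=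
  1 ≤ d₁ ∧ d₁ ≤ d₂ ∧ d₂ ≤ d₃ ∧ d₁ + d₂ + d₃ = d ∧
    ∃ ρ : Fin 4 → (Fin 4 → S),
      (∀ j, IsHomogeneousVec (ρ j) (![d₁, d₂, d₃, d₃] j)) ∧
      Submodule.span S (Set.range ρ) = AR f ∧
      ∀ j, ρ j ∉ Submodule.span S (ρ '' {j}ᶜ)

/-- `ρ₁` is a nonzero homogeneous syzygy of minimal degree `e₁`, and `ρ₂` is a homogeneous syzygy
of degree `e₂` which represents a nonzero homogeneous element of minimal degree in
`AR(f) / S ρ₁`. -/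
structure IsMinimalPair (f : S) (ρ₁ ρ₂ : Fin 4 → S) (e₁ e₂ : ℕ) : Prop where
  mem₁ : ρ₁ ∈ AR f
  ne_zero : ρ₁ ≠ 0
  homog₁ : IsHomogeneousVec ρ₁ e₁
  minimal₁ : ∀ (q : ℕ), ∀ σ ∈ AR f, σ ≠ 0 → IsHomogeneousVec σ q → e₁ ≤ q
  mem₂ : ρ₂ ∈ AR f
  notMem_span : ρ₂ ∉ Submodule.span S {ρ₁}
  homog₂ : IsHomogeneousVec ρ₂ e₂
  minimal₂ : ∀ (q : ℕ), ∀ σ ∈ AR f, σ ∉ Submodule.span S {ρ₁} → IsHomogeneousVec σ q → e₂ ≤ q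

/-- The algebra `Ω^*` of algebraic differential forms on `ℂ⁴`: the exterior algebra of the free
module `Ω¹ = S⁴` with basis `dx, dy, dz, dw`. -/
abbrev Forms : Type := ExteriorAlgebra S (Fin 4 → S)

/-- The 1-form `ω(ρ) = α dx + β dy + γ dz + δ dw` of `ρ = (α, β, γ, δ)`. -/
abbrev omega (ρ : Fin 4 → S) : Forms := ExteriorAlgebra.ι S ρ

/-- The map `u : (a, b) ↦ a ω(ρ₁) + b ω(ρ₂)`, with `Ω¹₀ = {ω(ρ) : ρ ∈ AR(f)}` identified with
`AR(f)` through the injective map `ω`. -/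
def mapU (f : S) (ρ₁ ρ₂ : AR f) : (S × S) →ₗ[S] AR f :=
  (LinearMap.toSpanSingleton S (AR f) ρ₁).coprod (LinearMap.toSpanSingleton S (AR f) ρ₂)

/-- The map `v : ω(ρ) ↦ ω(ρ₁) ∧ ω(ρ₂) ∧ ω(ρ)` on `Ω¹₀`, identified with `AR(f)`. -/
def mapV (f : S) (ρ₁ ρ₂ : AR f) : AR f →ₗ[S] Forms :=
  (LinearMap.mulLeft S (omega ρ₁ * omega ρ₂)) ∘ₗ (ExteriorAlgebra.ι S) ∘ₗ (AR f).subtype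

/-- The surface `f = 0` is tame with respect to the pair `ρ₁, ρ₂` of syzygies of degrees `e₁, e₂`:
the pair is minimal as above, and `S(-e₁-1) ⊕ S(-e₂-1) → Ω¹₀ → Ω³(e₁+e₂+2)` is exact. -/
def IsTameWith (f : S) (ρ₁ ρ₂ : Fin 4 → S) (e₁ e₂ : ℕ) : Prop :=
  ∃ h : IsMinimalPair f ρ₁ ρ₂ e₁ e₂,
    Function.Exact (mapU f ⟨ρ₁, h.mem₁⟩ ⟨ρ₂, h.mem₂⟩) (mapV f ⟨ρ₁, h.mem₁⟩ ⟨ρ₂, h.mem₂⟩)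

end

end ProjSurface

/-! For a syzygy ρ, the signed 3 × 3 minors of the matrix with rows ρ₁, ρ₂, ρ form a vector
proportional to the gradient of f, because all three rows annihilate that gradient. Since f is
reduced, its partial derivatives have no common factor, so the minors equal ψ(ρ) times the gradient
for a linear map ψ : AR(f) → S that lowers degrees by e₃ (`exists_isCofactorMap`). Tameness says
that ker ψ is Sρ₁ + Sρ₂, and this module is free.

Let I be the image of ψ. Counting dimensions in 0 → Sρ₁ ⊕ Sρ₂ → AR(f) → I → 0 and 0 → AR(f) → S⁴ →
J_f → 0 gives deg Σ = s₁² - s₂ - α, where αk + β is the Hilbert polynomial of S/I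
(`IsCofactorMap.exists_linear_hilbertFn`). If I = S, the surface is free; so I is proper and only α
remains to be studied.

The bound is α ≥ 1. Since AR(f) is reflexive and ker ψ is free, a proper I cannot have codimension
three or more. Concretely, if dim (S/I)_k ≤ k for some k, then I contains a nonzero form in any two
of the variables. Choose a in x, y and b in z, w: they are coprime products of linear forms, and
splitting off linear factors shows ((a, b) : I) = (a, b). For ρ_a, ρ_b above a, b, the syzygy bρ_a -
aρ_b lies in ker ψ, and I multiplies its coefficients into (a, b), so they already lie there. Hence
ρ_a can be corrected by ρ₁, ρ₂ to become divisible by a, and the quotient has ψ = 1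
(`IsCofactorMap.range_eq_top`).

For equality: when the surface is nearly free, I is generated by two linear forms and α = 1 · 1.
Conversely, two extra generators of AR(f) make I generated by two elements, hence by two coprime
forms of degrees p, q with pq = α = 1; lifting these two linear forms to AR(f) gives the missing
generators. -/

namespace ProjSurface

/-! ### Eventually polynomial functions -/

section Polynomials

/-- Every rational polynomial is the forward difference of a rational polynomial. -/
lemma exists_forwardDiff_eq (P : Polynomial ℚ) :
    ∃ Q : Polynomial ℚ, ∀ x : ℚ, Q.eval (x + 1) - Q.eval x = P.eval x := by
  induction P using Polynomial.induction_on' with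
  | add p q hp hq =>
    obtain ⟨P, hP⟩ := hp
    obtain ⟨Q, hQ⟩ := hq
    exact ⟨P + Q, fun x => by simp only [Polynomial.eval_add, ← hP, ← hQ]; ring⟩
  | monomial n a =>
    refine ⟨Polynomial.C (a / (n + 1)) * Polynomial.bernoulli (n + 1), fun x => ?_⟩
    have h := Polynomial.bernoulli_eval_one_add (n + 1) x
    have hn : (n : ℚ) + 1 ≠ 0 := by positivity
    rw [add_comm x 1]
    simp only [Polynomial.eval_mul, Polynomial.eval_C, Polynomial.eval_monomial, h]
    push_cast
    field_simp
    ring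

/-- A function on `ℕ` which agrees with a polynomial at all large integers. -/
def EventuallyPolynomial (h : ℕ → ℚ) : Prop :=
  ∃ P : Polynomial ℚ, ∀ᶠ k : ℕ in Filter.atTop, P.eval (k : ℚ) = h k

lemma EventuallyPolynomial.of_forwardDiff {h : ℕ → ℚ}
    (hd : EventuallyPolynomial fun k => h (k + 1) - h k) : EventuallyPolynomial h := by
  obtain ⟨P, hP⟩ := hd
  obtain ⟨Q, hQ⟩ := exists_forwardDiff_eq P
  obtain ⟨N, hN⟩ := Filter.eventually_atTop.1 hP
  refine ⟨Q + Polynomial.C (h N - Q.eval (N : ℚ)), Filter.eventually_atTop.2 ⟨N, fun k hk => ?_⟩⟩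
  induction k, hk using Nat.le_induction with
  | base => simp
  | succ k hk ih =>
    have h1 := hN k hk
    have h2 := hQ k
    simp only [Polynomial.eval_add, Polynomial.eval_C] at ih ⊢
    push_cast
    linarith

lemma EventuallyPolynomial.comp_pred {h g : ℕ → ℚ} (hg : EventuallyPolynomial g)
    (hh : ∀ k, h (k + 1) = g k) : EventuallyPolynomial h := by
  obtain ⟨P, hP⟩ := hg
  obtain ⟨N, hN⟩ := Filter.eventually_atTop.1 hP
  refine ⟨P.comp (Polynomial.X - 1), Filter.eventually_atTop.2 ⟨N + 1, fun k hk => ?_⟩⟩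
  obtain ⟨k, rfl⟩ : ∃ j, k = j + 1 := ⟨k - 1, by omega⟩
  rw [hh, ← hN k (by omega)]
  simp

lemma EventuallyPolynomial.comp_succ {g : ℕ → ℚ} (hg : EventuallyPolynomial g) :
    EventuallyPolynomial fun k => g (k + 1) := by
  obtain ⟨P, hP⟩ := hg
  obtain ⟨N, hN⟩ := Filter.eventually_atTop.1 hP
  refine ⟨P.comp (Polynomial.X + 1), Filter.eventually_atTop.2 ⟨N, fun k hk => ?_⟩⟩
  change _ = g (k + 1)
  rw [← hN (k + 1) (by omega)]
  simp

lemma EventuallyPolynomial.add {g h : ℕ → ℚ} (hg : EventuallyPolynomial g)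
    (hh : EventuallyPolynomial h) : EventuallyPolynomial fun k => g k + h k := by
  obtain ⟨P, hP⟩ := hg
  obtain ⟨Q, hQ⟩ := hh
  refine ⟨P + Q, ?_⟩
  filter_upwards [hP, hQ] with k h1 h2
  rw [Polynomial.eval_add, h1, h2]

/-- Two polynomials which agree at all large integers are equal. -/
lemma polynomial_eq_of_eventually_eval_eq {P Q : Polynomial ℚ}
    (h : ∀ᶠ k : ℕ in Filter.atTop, P.eval (k : ℚ) = Q.eval (k : ℚ)) : P = Q := by
  obtain ⟨N, hN⟩ := Filter.eventually_atTop.1 h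
  refine Polynomial.eq_of_infinite_eval_eq P Q ?_
  refine Set.Infinite.mono (s := (fun k : ℕ => (k : ℚ)) '' Set.Ici N) ?_
    ((Set.Ici_infinite N).image Nat.cast_injective.injOn)
  rintro _ ⟨k, hk, rfl⟩
  exact hN k hk

end Polynomials

/-! ### Homogeneous components and factors of forms -/

section Homogeneous

variable {σ : Type*} {R : Type*} [CommRing R]

lemma homogeneousComponent_mul_add {b : MvPolynomial σ R} {e : ℕ} (hb : b.IsHomogeneous e)
    (a : MvPolynomial σ R) (k : ℕ) :
    homogeneousComponent (k + e) (a * b) = homogeneousComponent k a * b := by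
  classical
  conv_lhs => rw [← sum_homogeneousComponent a, Finset.sum_mul, map_sum]
  have h : ∀ i ∈ Finset.range (a.totalDegree + 1),
      homogeneousComponent (k + e) (homogeneousComponent i a * b) =
        if k = i then homogeneousComponent k a * b else 0 := by
    intro i _
    rw [homogeneousComponent_of_mem (((homogeneousComponent_isHomogeneous i a).mul hb))]
    by_cases hi : k = i
    · subst hi; simp
    · rw [if_neg (by omega), if_neg hi]
  rw [Finset.sum_congr rfl h, Finset.sum_ite_eq]
  split_ifs with hk
  · rfl
  · rw [homogeneousComponent_eq_zero _ _ (by simpa using hk), zero_mul]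

lemma homogeneousComponent_mul_of_lt {b : MvPolynomial σ R} {e : ℕ} (hb : b.IsHomogeneous e)
    (a : MvPolynomial σ R) {k : ℕ} (hk : k < e) :
    homogeneousComponent k (a * b) = 0 := by
  classical
  conv_lhs => rw [← sum_homogeneousComponent a, Finset.sum_mul, map_sum]
  refine Finset.sum_eq_zero fun i _ => ?_
  rw [homogeneousComponent_of_mem (((homogeneousComponent_isHomogeneous i a).mul hb)),
    if_neg (by omega)]

lemma isHomogeneous_of_homogeneousComponent_eq {p : MvPolynomial σ R} {n : ℕ}
    (h : homogeneousComponent n p = p) : p.IsHomogeneous n := by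
  rw [← h]; exact homogeneousComponent_isHomogeneous n p

/-- The substitution `X i ↦ X i * T`, which records the degree in the variable `T`. -/
noncomputable def gradingHom (σ R : Type*) [CommRing R] :
    MvPolynomial σ R →ₐ[R] Polynomial (MvPolynomial σ R) :=
  aeval fun i => Polynomial.C (X i) * Polynomial.X

lemma gradingHom_of_isHomogeneous {p : MvPolynomial σ R} {n : ℕ} (hp : p.IsHomogeneous n) :
    gradingHom σ R p = Polynomial.monomial n p := by
  have key : ∀ (s : σ →₀ ℕ) (c : R), gradingHom σ R (monomial s c) =
      Polynomial.monomial s.degree (monomial s c) := by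
    intro s c
    rw [gradingHom, aeval_monomial, monomial_eq, Finsupp.prod, Finsupp.prod, Finsupp.degree_apply]
    simp only [mul_pow, Finset.prod_mul_distrib, Finset.prod_pow_eq_pow_sum]
    rw [← Polynomial.C_mul_X_pow_eq_monomial, map_mul, map_prod, ← mul_assoc]
    simp only [map_pow]
    rfl
  conv_lhs => rw [p.as_sum]
  conv_rhs => rw [p.as_sum]
  rw [map_sum, map_sum]
  refine Finset.sum_congr rfl fun s hs => ?_
  rw [key, hp.degree_eq_sum_deg_support hs, Finsupp.degree_apply]

lemma gradingHom_coeff (p : MvPolynomial σ R) (n : ℕ) :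
    (gradingHom σ R p).coeff n = homogeneousComponent n p := by
  classical
  conv_lhs => rw [← sum_homogeneousComponent p, map_sum]
  simp only [gradingHom_of_isHomogeneous (homogeneousComponent_isHomogeneous _ p),
    Polynomial.finsetSum_coeff, Polynomial.coeff_monomial]
  rw [Finset.sum_ite_eq']
  split_ifs with h
  · rfl
  · rw [homogeneousComponent_eq_zero _ _ (by simpa using h)]

lemma gradingHom_injective : Function.Injective (gradingHom σ R) := by
  intro p q h
  have : ∀ n, homogeneousComponent n p = homogeneousComponent n q := fun n => by
    rw [← gradingHom_coeff, h, gradingHom_coeff]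
  ext s
  have h := congrArg (coeff s) (this s.degree)
  simpa [coeff_homogeneousComponent] using h

/-- The factors of a nonzero homogeneous polynomial over a domain are homogeneous. -/
lemma exists_isHomogeneous_of_mul [IsDomain R] {p q : MvPolynomial σ R} {n : ℕ}
    (h : (p * q).IsHomogeneous n) (h0 : p * q ≠ 0) :
    ∃ i j, i + j = n ∧ p.IsHomogeneous i ∧ q.IsHomogeneous j := by
  have hp : gradingHom σ R p ≠ 0 := fun hp =>
    left_ne_zero_of_mul h0 (gradingHom_injective (by rw [hp, map_zero]))
  have hq : gradingHom σ R q ≠ 0 := fun hq =>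
    right_ne_zero_of_mul h0 (gradingHom_injective (by rw [hq, map_zero]))
  have hpq := gradingHom_of_isHomogeneous h
  rw [map_mul] at hpq
  -- Degree and trailing degree in `T` are both additive. They agree for the product, which is a
  -- monomial in `T`, hence they agree for each factor.
  have h1 := Polynomial.natDegree_mul hp hq
  have h2 := Polynomial.natTrailingDegree_mul hp hq
  rw [hpq, Polynomial.natDegree_monomial_eq _ h0] at h1
  rw [hpq, Polynomial.natTrailingDegree_monomial h0] at h2
  have h3 := Polynomial.natTrailingDegree_le_natDegree (gradingHom σ R p)
  have h4 := Polynomial.natTrailingDegree_le_natDegree (gradingHom σ R q)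
  have key : ∀ r : MvPolynomial σ R,
      (gradingHom σ R r).natTrailingDegree = (gradingHom σ R r).natDegree →
      r.IsHomogeneous (gradingHom σ R r).natDegree := by
    intro r hr
    refine isHomogeneous_of_homogeneousComponent_eq ?_
    refine gradingHom_injective ?_
    rw [gradingHom_of_isHomogeneous (homogeneousComponent_isHomogeneous _ r)]
    ext1 m
    rw [Polynomial.coeff_monomial, ← gradingHom_coeff]
    split_ifs with hm
    · rw [hm]
    · rcases lt_or_gt_of_ne hm with hm | hm
      · rw [Polynomial.coeff_eq_zero_of_natDegree_lt hm]
      · rw [Polynomial.coeff_eq_zero_of_lt_natTrailingDegree (by omega)]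
  exact ⟨_, _, h1.symm, key p (by omega), key q (by omega)⟩

lemma isUnit_of_isHomogeneous_zero {K : Type*} [Field K] {p : MvPolynomial σ K}
    (hp : p.IsHomogeneous 0) (h0 : p ≠ 0) : IsUnit p := by
  have h := homogeneousComponent_eq_self hp
  rw [homogeneousComponent_zero] at h
  rw [← h] at h0 ⊢
  refine IsUnit.map C (isUnit_iff_ne_zero.2 fun h => h0 ?_)
  rw [h, C_0]

lemma not_isUnit_of_isHomogeneous {K : Type*} [Field K] {p : MvPolynomial σ K} {n : ℕ}
    (hp : p.IsHomogeneous n) (hn : n ≠ 0) : ¬ IsUnit p := by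
  intro hu
  have h := hu.map (constantCoeff (σ := σ) (R := K))
  rw [constantCoeff_eq, hp.coeff_eq_zero (by simpa using hn.symm)] at h
  exact not_isUnit_zero h

end Homogeneous

/-! ### Hilbert functions of graded quotients and the Hilbert–Serre theorem -/

section HilbertFunction

/-- The graded piece `S_k`. -/
noncomputable abbrev Piece (k : ℕ) : Submodule ℂ S := homogeneousSubmodule (Fin 4) ℂ k

/-- The Hilbert function `k ↦ dim (S / I)_k`. -/
noncomputable def hilbertFn (I : Ideal S) (k : ℕ) : ℕ :=
  Module.finrank ℂ ((Piece k).map (Ideal.Quotient.mkₐ ℂ I).toLinearMap)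

/-- The forms of degree `k` in the ideal `I`. -/
noncomputable def idealPiece (I : Ideal S) (k : ℕ) : Submodule ℂ S :=
  I.restrictScalars ℂ ⊓ Piece k

/-- The ideal `I` contains the homogeneous components of its elements. -/
def IsGradedIdeal (I : Ideal S) : Prop :=
  ∀ p ∈ I, ∀ k, homogeneousComponent k p ∈ I

lemma mem_idealPiece {I : Ideal S} {k : ℕ} {p : S} :
    p ∈ idealPiece I k ↔ p ∈ I ∧ p.IsHomogeneous k := Iff.rfl

instance (k : ℕ) : FiniteDimensional ℂ (Piece k) :=
  Module.Finite.of_fg (homogeneousSubmodule_fg _ _ k)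

instance (I : Ideal S) (k : ℕ) : FiniteDimensional ℂ (idealPiece I k) :=
  Submodule.finiteDimensional_of_le (inf_le_right : idealPiece I k ≤ Piece k)

lemma finrank_piece (k : ℕ) : Module.finrank ℂ (Piece k) = (k + 3).choose 3 := by
  classical
  have h : Piece k = AddMonoidAlgebra.supported ℂ ℂ {d : Fin 4 →₀ ℕ | d.degree = k} :=
    homogeneousSubmodule_eq_finsupp_supported (Fin 4) ℂ k
  have h2 : {d : Fin 4 →₀ ℕ | d.degree = k} =
      ↑(Finset.finsuppAntidiag (Finset.univ : Finset (Fin 4)) k) := by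
    ext d
    simp [Finset.mem_finsuppAntidiag, Finsupp.degree_eq_sum]
  rw [h, (AddMonoidAlgebra.supportedEquivFinsupp (R := ℂ) (S := ℂ)
    {d : Fin 4 →₀ ℕ | d.degree = k}).finrank_eq, h2, Module.finrank_finsupp_self]
  simp only [Finset.coe_sort_coe, Fintype.card_coe]
  rw [Finset.card_finsuppAntidiag_nat_eq_choose]
  rw [Finset.card_univ, Fintype.card_fin, show 4 + k - 1 = k + 3 by omega, Nat.choose_symm_add]

lemma hilbertFn_add_finrank (I : Ideal S) (k : ℕ) :
    hilbertFn I k + Module.finrank ℂ (idealPiece I k) = (k + 3).choose 3 := by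
  rw [← finrank_piece, ← LinearMap.finrank_range_add_finrank_ker
    ((Ideal.Quotient.mkₐ ℂ I).toLinearMap.domRestrict (Piece k)), LinearMap.range_domRestrict]
  congr 1
  have : LinearMap.ker ((Ideal.Quotient.mkₐ ℂ I).toLinearMap.domRestrict (Piece k)) =
      (idealPiece I k).comap (Piece k).subtype := by
    ext p
    simp [mem_idealPiece, Ideal.Quotient.eq_zero_iff_mem]
    intro _
    exact p.2
  rw [this]
  exact (Submodule.comapSubtypeEquivOfLe (inf_le_right : idealPiece I k ≤ Piece k)).finrank_eq.symm

lemma finrank_map_mulLeft {x : S} (hx : x ≠ 0) (V : Submodule ℂ S) :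
    Module.finrank ℂ (V.map (LinearMap.mulLeft ℂ x)) = Module.finrank ℂ V :=
  (Submodule.equivMapOfInjective _ (fun _ _ h => mul_left_cancel₀ hx h) V).finrank_eq.symm

/-- The colon ideal `I : x`. -/
noncomputable def colonIdeal (I : Ideal S) (x : S) : Ideal S := Submodule.comap (LinearMap.mulLeft S x) I

lemma mem_colonIdeal {I : Ideal S} {x p : S} : p ∈ colonIdeal I x ↔ x * p ∈ I := Iff.rfl

lemma IsGradedIdeal.colon {I : Ideal S} (hI : IsGradedIdeal I) {x : S} {e : ℕ}
    (hx : x.IsHomogeneous e) : IsGradedIdeal (colonIdeal I x) := by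
  intro p hp k
  rw [mem_colonIdeal, mul_comm] at hp ⊢
  rw [← homogeneousComponent_mul_add hx]
  exact hI _ hp _

lemma IsGradedIdeal.sup {I J : Ideal S} (hI : IsGradedIdeal I) (hJ : IsGradedIdeal J) :
    IsGradedIdeal (I ⊔ J) := by
  intro p hp k
  obtain ⟨a, ha, b, hb, rfl⟩ := Submodule.mem_sup.1 hp
  rw [map_add]
  exact Submodule.add_mem_sup (hI a ha k) (hJ b hb k)

lemma isGradedIdeal_span_singleton {x : S} {e : ℕ} (hx : x.IsHomogeneous e) :
    IsGradedIdeal (Ideal.span {x}) := by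
  intro p hp k
  obtain ⟨a, rfl⟩ := Ideal.mem_span_singleton'.1 hp
  rcases lt_or_ge k e with hk | hk
  · rw [homogeneousComponent_mul_of_lt hx _ hk]; exact zero_mem _
  · obtain ⟨j, rfl⟩ := Nat.exists_eq_add_of_le' hk
    rw [homogeneousComponent_mul_add hx]
    exact Ideal.mem_span_singleton'.2 ⟨_, rfl⟩

/-- The exact sequence `0 → S/(I : x)(-1) → S/I → S/(I + x) → 0`. -/
lemma hilbertFn_succ {I : Ideal S} (hI : IsGradedIdeal I) {x : S} (hx : x.IsHomogeneous 1)
    (hx0 : x ≠ 0) (k : ℕ) :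
    hilbertFn I (k + 1) =
      hilbertFn (colonIdeal I x) k + hilbertFn (I ⊔ Ideal.span {x}) (k + 1) := by
  have h1 := hilbertFn_add_finrank I (k + 1)
  have h2 := hilbertFn_add_finrank (colonIdeal I x) k
  have h3 := hilbertFn_add_finrank (I ⊔ Ideal.span {x}) (k + 1)
  have hsup : idealPiece I (k + 1) ⊔ (Piece k).map (LinearMap.mulLeft ℂ x) =
      idealPiece (I ⊔ Ideal.span {x}) (k + 1) := by
    apply le_antisymm
    · refine sup_le (fun p hp => ⟨Submodule.mem_sup_left hp.1, hp.2⟩) ?_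
      rintro _ ⟨p, hp, rfl⟩
      refine ⟨Submodule.mem_sup_right (Ideal.mem_span_singleton'.2 ⟨p, mul_comm _ _⟩), ?_⟩
      have := hx.mul hp
      rwa [add_comm] at this
    · rintro p ⟨hp, hph⟩
      obtain ⟨a, ha, b, hb, rfl⟩ := Submodule.mem_sup.1 hp
      obtain ⟨c, rfl⟩ := Ideal.mem_span_singleton'.1 hb
      have h := homogeneousComponent_eq_self hph
      rw [map_add, homogeneousComponent_mul_add hx] at h
      rw [← h]
      refine Submodule.add_mem_sup ⟨hI a ha _, homogeneousComponent_isHomogeneous _ _⟩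
        ⟨homogeneousComponent k c, homogeneousComponent_isHomogeneous _ _, mul_comm _ _⟩
  have hinf : idealPiece I (k + 1) ⊓ (Piece k).map (LinearMap.mulLeft ℂ x) =
      (idealPiece (colonIdeal I x) k).map (LinearMap.mulLeft ℂ x) := by
    ext p
    constructor
    · rintro ⟨hp, q, hq, rfl⟩
      exact ⟨q, ⟨hp.1, hq⟩, rfl⟩
    · rintro ⟨q, ⟨hq1, hq2⟩, rfl⟩
      refine ⟨⟨hq1, ?_⟩, q, hq2, rfl⟩
      have := hx.mul hq2
      rwa [add_comm] at this
  have h4 := Submodule.finrank_sup_add_finrank_inf_eq (idealPiece I (k + 1))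
    ((Piece k).map (LinearMap.mulLeft ℂ x))
  rw [hsup, hinf, finrank_map_mulLeft hx0, finrank_map_mulLeft hx0, finrank_piece] at h4
  omega

lemma hilbertFn_eq_zero_of_X_mem {I : Ideal S} (h : ∀ i, X i ∈ I) (k : ℕ) :
    hilbertFn I (k + 1) = 0 := by
  have hle : idealPiece I (k + 1) = Piece (k + 1) := by
    refine inf_eq_right.2 fun p hp => ?_
    change p ∈ I
    rw [p.as_sum]
    refine I.sum_mem fun s hs => ?_
    have hs : s ≠ 0 := by
      rintro rfl
      rw [mem_support_iff, hp.coeff_eq_zero (by simp)] at hs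
      exact hs rfl
    obtain ⟨i, hi⟩ := Finsupp.ne_iff.1 hs
    refine I.mem_of_dvd (?_ : X i ∣ monomial s (coeff s p)) (h i)
    rw [X_dvd_monomial]
    exact Or.inr hi
  have h1 := hilbertFn_add_finrank I (k + 1)
  rw [hle, finrank_piece] at h1
  omega

/-- **Hilbert–Serre**: the Hilbert function of a graded quotient of `S` is eventually
polynomial. -/
theorem eventuallyPolynomial_hilbertFn {I : Ideal S} (hI : IsGradedIdeal I) :
    EventuallyPolynomial fun k => (hilbertFn I k : ℚ) := by
  -- Induction on the number of variables not yet known to lie in `I`, and inside it Noetherian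
  -- induction on `I`.
  suffices H : ∀ n ≤ 4, ∀ I : Ideal S, IsGradedIdeal I → (∀ i : Fin 4, n ≤ i.1 → X i ∈ I) →
      EventuallyPolynomial fun k => (hilbertFn I k : ℚ) from
    H 4 le_rfl I hI fun i hi => absurd i.2 (by omega)
  intro n
  induction n with
  | zero =>
    intro _ I _ h
    refine ⟨0, Filter.eventually_atTop.2 ⟨1, fun k hk => ?_⟩⟩
    obtain ⟨k, rfl⟩ : ∃ j, k = j + 1 := ⟨k - 1, by omega⟩
    simp [hilbertFn_eq_zero_of_X_mem (fun i => h i (Nat.zero_le _))]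
  | succ n ih =>
    intro hn I
    induction I using IsNoetherian.induction with
    | hgt I ihI =>
    intro hI h
    have hx : (X (⟨n, by omega⟩ : Fin 4) : S).IsHomogeneous 1 := isHomogeneous_X _ _
    set x : S := X (⟨n, by omega⟩ : Fin 4) with hxdef
    have hx0 : x ≠ 0 := X_ne_zero _
    have hle : I ≤ colonIdeal I x := fun p hp => Ideal.mul_mem_left I x hp
    have hsum : EventuallyPolynomial fun k => (hilbertFn (I ⊔ Ideal.span {x}) k : ℚ) := by
      refine ih (by omega) _ (hI.sup (isGradedIdeal_span_singleton hx)) fun i hi => ?_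
      rcases Nat.eq_or_lt_of_le hi with hi | hi
      · refine Submodule.mem_sup_right ?_
        have : i = ⟨n, by omega⟩ := Fin.ext hi.symm
        rw [this]
        exact Ideal.mem_span_singleton_self _
      · exact Submodule.mem_sup_left (h i hi)
    -- If `I : x = I`, the exact sequence computes the first difference of the Hilbert function;
    -- otherwise `I : x` is strictly larger and the inner induction applies to it.
    rcases hle.eq_or_lt with heq | hlt
    · refine EventuallyPolynomial.of_forwardDiff ?_
      have := hsum.comp_succ
      convert this using 2 with k
      rw [hilbertFn_succ hI hx hx0, ← heq]
      push_cast
      ring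
    · have h1 := ihI _ hlt (hI.colon hx) fun i hi => hle (h i hi)
      refine (h1.add hsum.comp_succ).comp_pred fun k => ?_
      rw [hilbertFn_succ hI hx hx0]
      push_cast
      rfl

end HilbertFunction

/-! ### Partial derivatives of a reduced form have no common factor -/

section Partials

/-- If p divides every partial, Euler's formula gives f = pg, and p does not divide g since f is
squarefree. By Leibniz p divides each partial of p, which therefore vanishes for degree reasons;
Euler's formula for p then makes p constant. -/
lemma exists_not_dvd_pderiv {f : S} {d : ℕ} (hf : f.IsHomogeneous d) (hd : d ≠ 0)
    (hred : Squarefree f) {p : S} (hp : Prime p) : ∃ i, ¬ p ∣ pderiv i f := by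
  by_contra! h
  have hpf : p ∣ f := by
    have h1 : p ∣ ∑ i, X i * pderiv i f := Finset.dvd_sum fun i _ => (h i).mul_left _
    rw [hf.sum_X_mul_pderiv, nsmul_eq_mul] at h1
    refine (hp.dvd_or_dvd h1).resolve_left fun h2 => hp.not_isUnit (isUnit_of_dvd_unit h2 ?_)
    have : ((d : ℂ) : ℂ) ≠ 0 := Nat.cast_ne_zero.2 hd
    simpa using (isUnit_iff_ne_zero.2 this).map (C : ℂ →+* S)
  obtain ⟨g, rfl⟩ := hpf
  have hg : ¬ p ∣ g := fun hg => hp.not_isUnit (hred p (mul_dvd_mul_left p hg))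
  obtain ⟨n, m, -, hn, -⟩ := exists_isHomogeneous_of_mul hf hred.ne_zero
  have hder : ∀ i, pderiv i p = 0 := by
    intro i
    have h1 := h i
    rw [Derivation.leibniz, smul_eq_mul, smul_eq_mul] at h1
    have h2 := (hp.dvd_or_dvd ((dvd_add_right (dvd_mul_right p _)).1 h1)).resolve_left hg
    by_contra h0
    obtain ⟨q, hq⟩ := h2
    have hn0 : n ≠ 0 := fun hn0 => hp.not_isUnit (isUnit_of_isHomogeneous_zero (hn0 ▸ hn) hp.ne_zero)
    have h3 := (hn.pderiv (i := i)).totalDegree h0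
    rw [hq, totalDegree_mul_of_isDomain hp.ne_zero (right_ne_zero_of_mul (hq ▸ h0)),
      hn.totalDegree hp.ne_zero] at h3
    omega
  have h1 := hn.sum_X_mul_pderiv
  simp only [hder, mul_zero, Finset.sum_const_zero] at h1
  have hn0 : n = 0 := by
    by_contra hn0
    exact hp.ne_zero ((smul_eq_zero.1 h1.symm).resolve_left hn0)
  exact hp.not_isUnit (isUnit_of_isHomogeneous_zero (hn0 ▸ hn) hp.ne_zero)

/-- If no prime divides all `g i`, and `a ∣ b * g i` for all `i`, then `a ∣ b`. -/
lemma dvd_of_forall_dvd_mul {ι R : Type*} [CommRing R] [IsDomain R] [UniqueFactorizationMonoid R]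
    {g : ι → R} (hg : ∀ p, Prime p → ∃ i, ¬ p ∣ g i) {a b : R} (ha : a ≠ 0)
    (h : ∀ i, a ∣ b * g i) : a ∣ b := by
  induction a using UniqueFactorizationMonoid.induction_on_prime generalizing b with
  | h₁ => exact absurd rfl ha
  | h₂ a hu => exact hu.dvd
  | h₃ a p ha0 hp ih =>
    obtain ⟨i, hi⟩ := hg p hp
    obtain ⟨c, rfl⟩ := (hp.dvd_or_dvd ((dvd_mul_right p a).trans (h i))).resolve_right hi
    refine mul_dvd_mul_left p (ih ha0 fun j => ?_)
    have := h j
    rwa [mul_assoc, mul_dvd_mul_iff_left hp.ne_zero] at this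

end Partials

/-! ### Maximal minors of three vectors in rank four -/

section Minors

variable {R : Type*} [CommRing R]

/-- The `3 × 3` minor of the rows `u, v, w` on the columns `i, j, k`. -/
def det3 (u v w : Fin 4 → R) (i j k : Fin 4) : R :=
  u i * (v j * w k - v k * w j) - u j * (v i * w k - v k * w i) + u k * (v i * w j - v j * w i)

/-- The vector of signed maximal minors of the `3 × 4` matrix with rows `u, v, w`, as a linear
function of `w`. -/
def crossMap (u v : Fin 4 → R) : (Fin 4 → R) →ₗ[R] (Fin 4 → R) where
  toFun w := ![det3 u v w 1 2 3, - det3 u v w 0 2 3, det3 u v w 0 1 3, - det3 u v w 0 1 2]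
  map_add' w w' := by
    ext l; fin_cases l <;> simp [det3] <;> ring
  map_smul' a w := by
    ext l; fin_cases l <;> simp [det3] <;> ring

/-- Contracting u ∧ v ∧ w with g gives a 2-form that vanishes because g is orthogonal to u, v, w. Up
to sign, its (p, q) coordinate is the required relation for the two complementary indices. -/
lemma crossMap_mul_comm {u v w g : Fin 4 → R} (hu : ∑ i, u i * g i = 0)
    (hv : ∑ i, v i * g i = 0) (hw : ∑ i, w i * g i = 0) (l m : Fin 4) :
    crossMap u v w l * g m = crossMap u v w m * g l := by
  rw [Fin.sum_univ_four] at hu hv hw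
  have key : ∀ p q, (v p * w q - v q * w p) * (u 0 * g 0 + u 1 * g 1 + u 2 * g 2 + u 3 * g 3)
      - (u p * w q - u q * w p) * (v 0 * g 0 + v 1 * g 1 + v 2 * g 2 + v 3 * g 3)
      + (u p * v q - u q * v p) * (w 0 * g 0 + w 1 * g 1 + w 2 * g 2 + w 3 * g 3) = 0 := by
    intro p q
    rw [hu, hv, hw]
    ring
  have h01 := key 2 3
  have h02 := key 1 3
  have h03 := key 1 2
  have h12 := key 0 3
  have h13 := key 0 2
  have h23 := key 0 1
  fin_cases l <;> fin_cases m <;> simp [crossMap, det3]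
  · linear_combination h01
  · linear_combination -h02
  · linear_combination h03
  · linear_combination -h01
  · linear_combination h12
  · linear_combination -h13
  · linear_combination h02
  · linear_combination -h12
  · linear_combination h23
  · linear_combination -h03
  · linear_combination h13
  · linear_combination -h23

lemma crossMap_self_left (u v : Fin 4 → R) : crossMap u v u = 0 := by
  ext l; fin_cases l <;> simp [crossMap, det3] <;> ring

lemma crossMap_self_right (u v : Fin 4 → R) : crossMap u v v = 0 := by
  ext l; fin_cases l <;> simp [crossMap, det3] <;> ring

lemma crossMap_eq_zero_of_minors {u v : Fin 4 → R} (h : ∀ i j, u i * v j - u j * v i = 0)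
    (w : Fin 4 → R) : crossMap u v w = 0 := by
  have h01 := h 0 1
  have h02 := h 0 2
  have h03 := h 0 3
  have h12 := h 1 2
  have h13 := h 1 3
  have h23 := h 2 3
  ext l; fin_cases l <;> simp [crossMap, det3]
  · linear_combination w 3 * h12 - w 2 * h13 + w 1 * h23
  · linear_combination -(w 3 * h02 - w 2 * h03 + w 0 * h23)
  · linear_combination w 3 * h01 - w 1 * h03 + w 0 * h13
  · linear_combination -(w 2 * h01 - w 1 * h02 + w 0 * h12)

lemma mul_mul_eq_zero_of_det3 {A : Type*} [Ring A] [Algebra R A] (e : Fin 4 → A)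
    (h0 : ∀ i, e i * e i = 0) (h1 : ∀ i j, e j * e i = -(e i * e j)) {u v w : Fin 4 → R}
    (h : crossMap u v w = 0) :
    (∑ i, u i • e i) * (∑ i, v i • e i) * (∑ i, w i • e i) = 0 := by
  have d0 : det3 u v w 1 2 3 = 0 := congrFun h 0
  have d1 : det3 u v w 0 2 3 = 0 := neg_eq_zero.1 (congrFun h 1)
  have d2 : det3 u v w 0 1 3 = 0 := congrFun h 2
  have d3 : det3 u v w 0 1 2 = 0 := neg_eq_zero.1 (congrFun h 3)
  have h0' : ∀ x i, x * e i * e i = 0 := fun x i => by rw [mul_assoc, h0, mul_zero]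
  have h1' : ∀ x i j, x * e j * e i = -(x * e i * e j) := fun x i j => by
    rw [mul_assoc, h1 i j, mul_neg, mul_assoc]
  have key : (∑ i, u i • e i) * (∑ i, v i • e i) * (∑ i, w i • e i) =
      det3 u v w 1 2 3 • (e 1 * e 2 * e 3) + det3 u v w 0 2 3 • (e 0 * e 2 * e 3) +
      det3 u v w 0 1 3 • (e 0 * e 1 * e 3) + det3 u v w 0 1 2 • (e 0 * e 1 * e 2) := by
    simp only [Fin.sum_univ_four, mul_add, add_mul, smul_mul_assoc, mul_smul_comm,
      h0, h0', h1 0 1, h1 0 2, h1 0 3, h1 1 2, h1 1 3, h1 2 3, h1' _ 0 1, h1' _ 0 2, h1' _ 0 3,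
      h1' _ 1 2, h1' _ 1 3, h1' _ 2 3, neg_mul, neg_neg, smul_neg, smul_zero, add_zero,
      zero_add, zero_mul, neg_zero, det3]
    module
  rw [key, d0, d1, d2, d3]
  simp

lemma omega_mul_omega_mul_omega_eq_zero {u v w : Fin 4 → S} (h : crossMap u v w = 0) :
    omega u * omega v * omega w = 0 := by
  have hexp : ∀ r : Fin 4 → S,
      omega r = ∑ i, r i • ExteriorAlgebra.ι S (Pi.single i (1 : S) : Fin 4 → S) := by
    intro r
    conv_lhs => rw [omega, pi_eq_sum_univ' r]
    simp only [map_sum, map_smul]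
  rw [hexp u, hexp v, hexp w]
  refine mul_mul_eq_zero_of_det3 _ (fun i => ExteriorAlgebra.ι_sq_zero _) (fun i j => ?_) h
  rw [eq_neg_iff_add_eq_zero]
  exact ExteriorAlgebra.ι_add_mul_swap _ _

end Minors

/-! ### Minors of syzygies as multiples of the gradient -/

section Syzygies

lemma mem_AR {f : S} {ρ : Fin 4 → S} : ρ ∈ AR f ↔ ∑ i, ρ i * pderiv i f = 0 := by
  simp [AR, LinearMap.mem_ker, Fintype.linearCombination_apply]

/-- If the partial derivatives of `f` have no common factor, then the maximal minors of three
syzygies are proportional to the partial derivatives. -/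
lemma exists_crossMap_eq_mul {f : S} (hg : ∀ p : S, Prime p → ∃ i, ¬ p ∣ pderiv i f)
    (h0 : ∃ i, pderiv i f ≠ 0) {u v : Fin 4 → S} (hu : u ∈ AR f) (hv : v ∈ AR f) :
    ∃ ψ : AR f →ₗ[S] S, ∀ (w : AR f) (l : Fin 4), crossMap u v w l = ψ w * pderiv l f := by
  obtain ⟨i, hi⟩ := h0
  -- The quotient is formed at one index with nonzero partial; proportionality carries it to the
  -- other indices, and cancelling that partial gives linearity.
  have hex : ∀ w : AR f, ∃ c, crossMap u v w i = c * pderiv i f := by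
    intro w
    have hd : pderiv i f ∣ crossMap u v w i := by
      refine dvd_of_forall_dvd_mul hg hi fun m => ?_
      rw [crossMap_mul_comm (mem_AR.1 hu) (mem_AR.1 hv) (mem_AR.1 w.2) i m]
      exact dvd_mul_left _ _
    obtain ⟨c, hc⟩ := hd
    exact ⟨c, hc.trans (mul_comm _ _)⟩
  choose c hc using hex
  refine ⟨{ toFun := c, map_add' := fun w w' => ?_, map_smul' := fun a w => ?_ }, fun w l => ?_⟩
  · refine mul_right_cancel₀ hi ?_
    rw [← hc, add_mul, ← hc, ← hc, Submodule.coe_add, map_add, Pi.add_apply]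
  · refine mul_right_cancel₀ hi ?_
    rw [← hc, RingHom.id_apply, smul_eq_mul, mul_assoc, ← hc, Submodule.coe_smul, map_smul,
      Pi.smul_apply, smul_eq_mul]
  · refine mul_right_cancel₀ hi ?_
    rw [crossMap_mul_comm (mem_AR.1 hu) (mem_AR.1 hv) (mem_AR.1 w.2) l i, hc]
    simp only [LinearMap.coe_mk, AddHom.coe_mk]
    ring

end Syzygies

/-! ### Homogeneous components of syzygies and minors -/

section Components

/-- The homogeneous component of degree `k` of a vector of polynomials. -/
noncomputable def vecComponent (k : ℕ) (w : Fin 4 → S) : Fin 4 → S :=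
  fun i => homogeneousComponent k (w i)

lemma isHomogeneousVec_vecComponent (k : ℕ) (w : Fin 4 → S) :
    IsHomogeneousVec (vecComponent k w) k := fun _ => homogeneousComponent_isHomogeneous _ _

lemma vecComponent_eq_self {k : ℕ} {w : Fin 4 → S} (hw : IsHomogeneousVec w k) :
    vecComponent k w = w := funext fun i => homogeneousComponent_eq_self (hw i)

lemma vecComponent_add (k : ℕ) (w w' : Fin 4 → S) :
    vecComponent k (w + w') = vecComponent k w + vecComponent k w' :=
  funext fun _ => map_add _ _ _

lemma vecComponent_smul {e : ℕ} {w : Fin 4 → S} (hw : IsHomogeneousVec w e) (a : S) (k : ℕ) :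
    vecComponent (k + e) (a • w) = homogeneousComponent k a • w :=
  funext fun i => homogeneousComponent_mul_add (hw i) a k

lemma vecComponent_smul_of_lt {e : ℕ} {w : Fin 4 → S} (hw : IsHomogeneousVec w e) (a : S) {k : ℕ}
    (hk : k < e) : vecComponent k (a • w) = 0 :=
  funext fun i => homogeneousComponent_mul_of_lt (hw i) a hk

lemma IsHomogeneousVec.smul {a : S} {w : Fin 4 → S} {m n : ℕ} (hw : IsHomogeneousVec w n)
    (ha : a.IsHomogeneous m) : IsHomogeneousVec (a • w) (m + n) := fun i => ha.mul (hw i)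

lemma vecComponent_mem_AR {f : S} {d : ℕ} (hf : f.IsHomogeneous d) {w : Fin 4 → S}
    (hw : w ∈ AR f) (k : ℕ) : vecComponent k w ∈ AR f := by
  rw [mem_AR] at hw ⊢
  have h := congrArg (homogeneousComponent (k + (d - 1))) hw
  rw [map_sum, map_zero] at h
  rw [← h]
  exact Finset.sum_congr rfl fun i _ => (homogeneousComponent_mul_add hf.pderiv _ _).symm

lemma homogeneousComponent_det3 {u v : Fin 4 → S} {a b : ℕ} (hu : IsHomogeneousVec u a)
    (hv : IsHomogeneousVec v b) (w : Fin 4 → S) (i j l : Fin 4) (k : ℕ) :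
    homogeneousComponent (k + (a + b)) (det3 u v w i j l) = det3 u v (vecComponent k w) i j l := by
  have h : ∀ w : Fin 4 → S, det3 u v w i j l = w l * (u i * v j - u j * v i) -
      w j * (u i * v l - u l * v i) + w i * (u j * v l - u l * v j) := by
    intro w; simp only [det3]; ring
  have hm : ∀ i j, (u i * v j - u j * v i).IsHomogeneous (a + b) := fun i j =>
    ((hu i).mul (hv j)).sub ((hu j).mul (hv i))
  rw [h, h, map_add, map_sub, homogeneousComponent_mul_add (hm _ _),
    homogeneousComponent_mul_add (hm _ _), homogeneousComponent_mul_add (hm _ _)]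
  rfl

lemma homogeneousComponent_crossMap {u v : Fin 4 → S} {a b : ℕ} (hu : IsHomogeneousVec u a)
    (hv : IsHomogeneousVec v b) (w : Fin 4 → S) (l : Fin 4) (k : ℕ) :
    homogeneousComponent (k + (a + b)) (crossMap u v w l) = crossMap u v (vecComponent k w) l := by
  fin_cases l <;> simp [crossMap, homogeneousComponent_det3 hu hv]

end Components

/-! ### The cofactor map ψ -/

section Cofactor

/-- `ψ` is the map `ρ ↦ h` on `AR(f)` with `ω(ρ₁) ∧ ω(ρ₂) ∧ ω(ρ) = h · ∗df`, whose kernel is the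
free module on `ρ₁, ρ₂`, and which lowers degrees by `e₃`. -/
structure IsCofactorMap (f : S) (ρ₁ ρ₂ : Fin 4 → S) (e₃ : ℕ) (ψ : AR f →ₗ[S] S) : Prop where
  eq_zero_iff : ∀ w, ψ w = 0 ↔ ∃ a b : S, (w : Fin 4 → S) = a • ρ₁ + b • ρ₂
  indep : ∀ a b : S, a • ρ₁ + b • ρ₂ = 0 → a = 0 ∧ b = 0
  component : ∀ (w : AR f) (q : ℕ) (h : vecComponent (q + e₃) w ∈ AR f),
    homogeneousComponent q (ψ w) = ψ ⟨_, h⟩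
  eq_zero_of_lt : ∀ (w : AR f) (q : ℕ), IsHomogeneousVec w q → q < e₃ → ψ w = 0

lemma IsCofactorMap.isHomogeneous {f : S} {ρ₁ ρ₂ : Fin 4 → S} {e₃ : ℕ} {ψ : AR f →ₗ[S] S}
    (hψ : IsCofactorMap f ρ₁ ρ₂ e₃ ψ) {w : AR f} {q : ℕ} (hw : IsHomogeneousVec w (q + e₃)) :
    (ψ w).IsHomogeneous q := by
  have h := vecComponent_eq_self hw
  refine isHomogeneous_of_homogeneousComponent_eq ?_
  rw [hψ.component w q (by rw [h]; exact w.2)]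
  congr 1
  exact Subtype.ext h

/-- The Koszul syzygy `f_j e_i - f_i e_j`. -/
noncomputable def koszul (f : S) (i j : Fin 4) : Fin 4 → S :=
  Pi.single i (pderiv j f) - Pi.single j (pderiv i f)

lemma koszul_mem (f : S) (i j : Fin 4) : koszul f i j ∈ AR f := by
  rw [mem_AR]
  simp only [koszul, Pi.sub_apply, sub_mul, Finset.sum_sub_distrib]
  rw [Finset.sum_eq_single i, Finset.sum_eq_single j]
  · simp [mul_comm]
  all_goals simp +contextual

/-- If all 2 × 2 minors vanished, so would every `crossMap ρ₁ ρ₂ w`, and all syzygies would be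
combinations of two proportional vectors. But two Koszul syzygies sharing the index i have the minor
f_i² ≠ 0. -/
lemma exists_minor_ne_zero {f : S} (h0 : ∃ i, pderiv i f ≠ 0) {ρ₁ ρ₂ : Fin 4 → S}
    (h : ∀ w ∈ AR f, crossMap ρ₁ ρ₂ w = 0 → ∃ a b : S, w = a • ρ₁ + b • ρ₂) :
    ∃ j k, ρ₁ j * ρ₂ k - ρ₁ k * ρ₂ j ≠ 0 := by
  by_contra! hm
  obtain ⟨i, hi⟩ := h0
  obtain ⟨j, k, hij, hik, hjk⟩ : ∃ j k : Fin 4, i ≠ j ∧ i ≠ k ∧ j ≠ k := by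
    have : ∀ i : Fin 4, ∃ j k : Fin 4, i ≠ j ∧ i ≠ k ∧ j ≠ k := by decide
    exact this i
  obtain ⟨a, b, hab⟩ := h _ (koszul_mem f i j) (crossMap_eq_zero_of_minors hm _)
  obtain ⟨c, d, hcd⟩ := h _ (koszul_mem f i k) (crossMap_eq_zero_of_minors hm _)
  have h1 := congrFun hab j
  have h2 := congrFun hab k
  have h3 := congrFun hcd j
  have h4 := congrFun hcd k
  simp [koszul, hij.symm, hik.symm, hjk, hjk.symm] at h1 h2 h3 h4
  refine hi (pow_eq_zero_iff (two_ne_zero) |>.1 ?_)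
  have := hm j k
  linear_combination (a * d - b * c) * this - (pderiv i f) * h4 + (c * ρ₁ k + d * ρ₂ k) * h1
    - (c * ρ₁ j + d * ρ₂ j) * h2

/-- The kernel is read off from tameness. The shift by e₃ arises because minors against ρ₁, ρ₂ raise
degrees by e₁ + e₂, while the partials have degree e₁ + e₂ + e₃. -/
lemma exists_isCofactorMap {f : S} {d : ℕ} (hf : f.IsHomogeneous d) (hred : Squarefree f)
    (h0 : ∃ i, pderiv i f ≠ 0) {ρ₁ ρ₂ : Fin 4 → S} {e₁ e₂ e₃ : ℕ}
    (htame : IsTameWith f ρ₁ ρ₂ e₁ e₂) (hd : e₁ + e₂ + e₃ + 1 = d) :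
    ∃ ψ : AR f →ₗ[S] S, IsCofactorMap f ρ₁ ρ₂ e₃ ψ := by
  obtain ⟨hmin, hex⟩ := htame
  have hcop : ∀ p : S, Prime p → ∃ i, ¬ p ∣ pderiv i f := fun p hp =>
    exists_not_dvd_pderiv hf (by omega) hred hp
  have hD : ∀ i, (pderiv i f).IsHomogeneous (e₃ + (e₁ + e₂)) := fun i => by
    have := hf.pderiv (i := i)
    rwa [show d - 1 = e₃ + (e₁ + e₂) by omega] at this
  have htm : ∀ w ∈ AR f, crossMap ρ₁ ρ₂ w = 0 → ∃ a b : S, w = a • ρ₁ + b • ρ₂ := by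
    intro w hw hc
    obtain ⟨⟨a, b⟩, hab⟩ := (hex ⟨w, hw⟩).1 (omega_mul_omega_mul_omega_eq_zero hc)
    refine ⟨a, b, ?_⟩
    have := congrArg Subtype.val hab
    simpa [mapU] using this.symm
  obtain ⟨ψ, hψ⟩ := exists_crossMap_eq_mul hcop h0 hmin.mem₁ hmin.mem₂
  obtain ⟨j, k, hjk⟩ := exists_minor_ne_zero h0 htm
  obtain ⟨i, hi⟩ := h0
  refine ⟨ψ, fun w => ⟨fun h => htm w w.2 ?_, ?_⟩, fun a b hab => ?_, fun w q h => ?_,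
    fun w q hw hq => ?_⟩
  · funext l
    rw [hψ, h, zero_mul, Pi.zero_apply]
  · rintro ⟨a, b, hab⟩
    have h := hψ w i
    rw [hab, map_add, map_smul, map_smul, crossMap_self_left, crossMap_self_right, smul_zero,
      smul_zero, add_zero, Pi.zero_apply] at h
    exact (mul_eq_zero.1 h.symm).resolve_right hi
  · have h1 := congrFun hab j
    have h2 := congrFun hab k
    simp only [Pi.add_apply, Pi.smul_apply, smul_eq_mul, Pi.zero_apply] at h1 h2
    constructor
    · refine (mul_eq_zero.1 ?_).resolve_right hjk
      linear_combination ρ₂ k * h1 - ρ₂ j * h2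
    · refine (mul_eq_zero.1 ?_).resolve_right hjk
      linear_combination ρ₁ j * h2 - ρ₁ k * h1
  · refine mul_right_cancel₀ hi ?_
    rw [← homogeneousComponent_mul_add (hD i), ← hψ, ← hψ, ← add_assoc,
      homogeneousComponent_crossMap hmin.homog₁ hmin.homog₂]
  · have h1 := homogeneousComponent_crossMap hmin.homog₁ hmin.homog₂ w i q
    rw [vecComponent_eq_self hw, hψ, homogeneousComponent_mul_of_lt (hD i) _ (by omega)] at h1
    exact (mul_eq_zero.1 h1.symm).resolve_right hi

end Cofactor

/-! ### From the Hilbert function of S/I to the degree of Σ -/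

section HilbertFunctionOfSyzygies

lemma finrank_eq_map_add_inf_ker {K M N : Type*} [Field K] [AddCommGroup M] [Module K M]
    [AddCommGroup N] [Module K N] (V : Submodule K M) [FiniteDimensional K V] (φ : M →ₗ[K] N) :
    Module.finrank K V =
      Module.finrank K (V.map φ) + Module.finrank K (V ⊓ LinearMap.ker φ : Submodule K M) := by
  rw [← LinearMap.finrank_range_add_finrank_ker (φ.domRestrict V), LinearMap.range_domRestrict]
  congr 1
  have : LinearMap.ker (φ.domRestrict V) = (V ⊓ LinearMap.ker φ).comap V.subtype := by
    ext p
    simp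
  rw [this]
  exact (Submodule.comapSubtypeEquivOfLe (inf_le_left : V ⊓ LinearMap.ker φ ≤ V)).finrank_eq

/-- The vectors in `S⁴` which are homogeneous of degree `k`. -/
noncomputable def vecPiece (k : ℕ) : Submodule ℂ (Fin 4 → S) := Submodule.pi Set.univ fun _ => Piece k

lemma mem_vecPiece {k : ℕ} {w : Fin 4 → S} : w ∈ vecPiece k ↔ IsHomogeneousVec w k := by
  simp [vecPiece, Submodule.mem_pi, IsHomogeneousVec]

/-- The space `vecPiece k` is the product of four copies of `S_k`. -/
noncomputable def vecPieceEquiv (k : ℕ) : (Fin 4 → Piece k) ≃ₗ[ℂ] vecPiece k where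
  toFun w := ⟨fun i => w i, mem_vecPiece.2 fun i => (w i).2⟩
  map_add' _ _ := rfl
  map_smul' _ _ := rfl
  invFun w i := ⟨w.1 i, mem_vecPiece.1 w.2 i⟩
  left_inv _ := rfl
  right_inv _ := rfl

instance (k : ℕ) : FiniteDimensional ℂ (vecPiece k) :=
  Module.Finite.equiv (vecPieceEquiv k)

lemma finrank_vecPiece (k : ℕ) : Module.finrank ℂ (vecPiece k) = 4 * (k + 3).choose 3 := by
  rw [← (vecPieceEquiv k).finrank_eq, Module.finrank_pi_fintype]
  simp [finrank_piece]

/-- The `ℂ`-linear map `S⁴ → S` whose kernel is `AR(f)`. -/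
noncomputable def gradMap (f : S) : (Fin 4 → S) →ₗ[ℂ] S :=
  (Fintype.linearCombination S fun i : Fin 4 => pderiv i f).restrictScalars ℂ

lemma gradMap_apply (f : S) (w : Fin 4 → S) : gradMap f w = ∑ i, w i * pderiv i f := by
  rw [gradMap, LinearMap.restrictScalars_apply, Fintype.linearCombination_apply]
  simp only [smul_eq_mul]

/-- The syzygies which are homogeneous of degree `k`. -/
noncomputable def syzygyPiece (f : S) (k : ℕ) : Submodule ℂ (AR f) :=
  (vecPiece k).comap ((AR f).subtype.restrictScalars ℂ)

lemma map_syzygyPiece (f : S) (k : ℕ) :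
    (syzygyPiece f k).map ((AR f).subtype.restrictScalars ℂ) =
      vecPiece k ⊓ LinearMap.ker (gradMap f) := by
  ext w
  constructor
  · rintro ⟨w, hw, rfl⟩
    exact ⟨hw, w.2⟩
  · rintro ⟨hw, hw'⟩
    exact ⟨⟨w, hw'⟩, hw, rfl⟩

lemma subtype_restrictScalars_injective (f : S) :
    Function.Injective ((AR f).subtype.restrictScalars ℂ) := Subtype.val_injective

instance (f : S) (k : ℕ) : FiniteDimensional ℂ (syzygyPiece f k) := by
  have : FiniteDimensional ℂ ((syzygyPiece f k).map ((AR f).subtype.restrictScalars ℂ)) := by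
    rw [map_syzygyPiece]
    exact Submodule.finiteDimensional_of_le inf_le_left
  exact Module.Finite.equiv (Submodule.equivMapOfInjective _
    (subtype_restrictScalars_injective f) (syzygyPiece f k)).symm

lemma map_vecPiece {f : S} {D : ℕ} (hD : ∀ i, (pderiv i f).IsHomogeneous D) (k : ℕ) :
    (vecPiece k).map (gradMap f) = idealPiece (jacobianIdeal f) (k + D) := by
  ext p
  rw [mem_idealPiece]
  constructor
  · rintro ⟨w, hw, rfl⟩
    rw [gradMap_apply]
    exact ⟨Ideal.sum_mem _ fun i _ => Ideal.mul_mem_left _ _ (Ideal.subset_span ⟨i, rfl⟩),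
      IsHomogeneous.sum _ _ _ fun i _ => (mem_vecPiece.1 hw i).mul (hD i)⟩
  · rintro ⟨hp, hph⟩
    obtain ⟨c, hc⟩ := Ideal.mem_span_range_iff_exists_fun.1 (show p ∈ Ideal.span _ from hp)
    refine ⟨vecComponent k c, mem_vecPiece.2 (isHomogeneousVec_vecComponent k c), ?_⟩
    rw [gradMap_apply, ← homogeneousComponent_eq_self hph, ← hc, map_sum]
    exact Finset.sum_congr rfl fun i _ => (homogeneousComponent_mul_add (hD i) _ _).symm

lemma finrank_jacobianIdeal_add_finrank_syzygyPiece {f : S} {D : ℕ}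
    (hD : ∀ i, (pderiv i f).IsHomogeneous D) (k : ℕ) :
    Module.finrank ℂ (idealPiece (jacobianIdeal f) (k + D)) +
      Module.finrank ℂ (syzygyPiece f k) = 4 * (k + 3).choose 3 := by
  rw [← finrank_vecPiece, finrank_eq_map_add_inf_ker (vecPiece k)
    (gradMap f), map_vecPiece hD, ← map_syzygyPiece]
  congr 1
  exact (Submodule.equivMapOfInjective _ (subtype_restrictScalars_injective f) _).finrank_eq

variable {f : S} {ρ₁ ρ₂ : Fin 4 → S} {e₁ e₂ e₃ : ℕ} {ψ : AR f →ₗ[S] S}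

lemma IsCofactorMap.map_syzygyPiece (hψ : IsCofactorMap f ρ₁ ρ₂ e₃ ψ) {d : ℕ}
    (hf : f.IsHomogeneous d) (k : ℕ) :
    (syzygyPiece f (k + e₃)).map (ψ.restrictScalars ℂ) = idealPiece (LinearMap.range ψ) k := by
  ext p
  constructor
  · rintro ⟨w, hw, rfl⟩
    exact ⟨⟨w, rfl⟩, hψ.isHomogeneous (mem_vecPiece.1 hw)⟩
  · rintro ⟨⟨w, rfl⟩, hp⟩
    have h := vecComponent_mem_AR hf w.2 (k + e₃)
    refine ⟨⟨_, h⟩, mem_vecPiece.2 (isHomogeneousVec_vecComponent _ _), ?_⟩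
    exact (hψ.component w k h).symm.trans (homogeneousComponent_eq_self hp)

lemma IsCofactorMap.isGradedIdeal (hψ : IsCofactorMap f ρ₁ ρ₂ e₃ ψ) {d : ℕ}
    (hf : f.IsHomogeneous d) : IsGradedIdeal (LinearMap.range ψ) := by
  rintro _ ⟨w, rfl⟩ k
  rw [hψ.component w k (vecComponent_mem_AR hf w.2 _)]
  exact ⟨_, rfl⟩

/-- The kernel is free on ρ₁, ρ₂, so its degree k part is S_{k₁} ⊕ S_{k₂}. Naming k₁ and k₂ avoids
truncated subtraction. -/
lemma IsCofactorMap.finrank_ker (hψ : IsCofactorMap f ρ₁ ρ₂ e₃ ψ) (h₁ : ρ₁ ∈ AR f)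
    (h₂ : ρ₂ ∈ AR f) (hρ₁ : IsHomogeneousVec ρ₁ e₁) (hρ₂ : IsHomogeneousVec ρ₂ e₂)
    {k k₁ k₂ : ℕ} (hk₁ : k₁ + e₁ = k) (hk₂ : k₂ + e₂ = k) :
    Module.finrank ℂ
      (syzygyPiece f k ⊓ LinearMap.ker (ψ.restrictScalars ℂ) : Submodule ℂ (AR f)) =
      (k₁ + 3).choose 3 + (k₂ + 3).choose 3 := by
  let κ : (Piece k₁ × Piece k₂) →ₗ[ℂ] AR f :=
    ((LinearMap.toSpanSingleton S (AR f) ⟨ρ₁, h₁⟩).restrictScalars ℂ ∘ₗ (Piece k₁).subtype).coprod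
    ((LinearMap.toSpanSingleton S (AR f) ⟨ρ₂, h₂⟩).restrictScalars ℂ ∘ₗ (Piece k₂).subtype)
  have hκ : ∀ x, (κ x : Fin 4 → S) = (x.1 : S) • ρ₁ + (x.2 : S) • ρ₂ := fun x => rfl
  have hinj : Function.Injective κ := by
    rw [← LinearMap.ker_eq_bot, LinearMap.ker_eq_bot']
    intro x hx
    have h := hψ.indep x.1 x.2 (by rw [← hκ, hx]; rfl)
    exact Prod.ext (Subtype.ext h.1) (Subtype.ext h.2)
  have hr : LinearMap.range κ = syzygyPiece f k ⊓ LinearMap.ker (ψ.restrictScalars ℂ) := by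
    ext w
    constructor
    · rintro ⟨x, rfl⟩
      refine ⟨mem_vecPiece.2 ?_, (hψ.eq_zero_iff _).2 ⟨_, _, hκ x⟩⟩
      intro i
      change ((κ x : Fin 4 → S) i).IsHomogeneous k
      rw [hκ]
      refine IsHomogeneous.add ?_ ?_
      · rw [← hk₁]; exact hρ₁.smul x.1.2 i
      · rw [← hk₂]; exact hρ₂.smul x.2.2 i
    · rintro ⟨hw, hw'⟩
      obtain ⟨a, b, hab⟩ := (hψ.eq_zero_iff w).1 hw'
      refine ⟨(⟨homogeneousComponent k₁ a, homogeneousComponent_isHomogeneous _ _⟩,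
        ⟨homogeneousComponent k₂ b, homogeneousComponent_isHomogeneous _ _⟩), Subtype.ext ?_⟩
      have h := vecComponent_eq_self (mem_vecPiece.1 hw)
      change vecComponent k (w : Fin 4 → S) = w at h
      rw [hκ, ← h, hab, vecComponent_add]
      conv_rhs => rw [← hk₁, vecComponent_smul hρ₁, hk₁, ← hk₂, vecComponent_smul hρ₂]
  rw [← hr, LinearMap.finrank_range_of_inj hinj, Module.finrank_prod, finrank_piece, finrank_piece]

/-- The Hilbert function of `M(f)` in terms of the one of `S / I`, where `I` is the image of the
cofactor map. -/
lemma IsCofactorMap.hilbertFn_jacobianIdeal (hψ : IsCofactorMap f ρ₁ ρ₂ e₃ ψ) {d : ℕ}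
    (hf : f.IsHomogeneous d) (hd : e₁ + e₂ + e₃ + 1 = d) (h₁ : ρ₁ ∈ AR f)
    (h₂ : ρ₂ ∈ AR f) (hρ₁ : IsHomogeneousVec ρ₁ e₁) (hρ₂ : IsHomogeneousVec ρ₂ e₂) (m : ℕ) :
    hilbertFn (jacobianIdeal f) (m + 2 * (e₁ + e₂ + e₃)) + hilbertFn (LinearMap.range ψ)
      (m + e₁ + e₂) + 4 * (m + e₁ + e₂ + e₃ + 3).choose 3 =
      (m + 2 * (e₁ + e₂ + e₃) + 3).choose 3 + (m + e₂ + e₃ + 3).choose 3 +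
      (m + e₁ + e₃ + 3).choose 3 + (m + e₁ + e₂ + 3).choose 3 := by
  have hD : ∀ i, (pderiv i f).IsHomogeneous (e₁ + e₂ + e₃) := fun i => by
    have := hf.pderiv (i := i)
    rwa [show d - 1 = e₁ + e₂ + e₃ by omega] at this
  -- Syzygies of degree m + s₁ map to degree m + e₁ + e₂ in I, and vectors of that degree map to
  -- degree m + 2s₁ in J_f; with this offset all shifted degrees are nonnegative.
  have hA := finrank_jacobianIdeal_add_finrank_syzygyPiece hD (m + e₁ + e₂ + e₃)
  have hB := finrank_eq_map_add_inf_ker (syzygyPiece f (m + e₁ + e₂ + e₃)) (ψ.restrictScalars ℂ)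
  rw [hψ.map_syzygyPiece hf (m + e₁ + e₂), hψ.finrank_ker h₁ h₂ hρ₁ hρ₂
    (k₁ := m + e₂ + e₃) (k₂ := m + e₁ + e₃) (by omega) (by omega)] at hB
  have hI := hilbertFn_add_finrank (LinearMap.range ψ) (m + e₁ + e₂)
  have hJ := hilbertFn_add_finrank (jacobianIdeal f) (m + e₁ + e₂ + e₃ + (e₁ + e₂ + e₃))
  rw [show m + 2 * (e₁ + e₂ + e₃) = m + e₁ + e₂ + e₃ + (e₁ + e₂ + e₃) by ring]
  omega

lemma cast_choose_three (k : ℕ) :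
    (((k + 3).choose 3 : ℕ) : ℚ) = (k + 1) * (k + 2) * (k + 3) / 6 := by
  have h : (k + 3).choose 3 * 6 = (k + 1) * (k + 2) * (k + 3) := by
    have := Nat.descFactorial_eq_factorial_mul_choose (k + 3) 3
    simp [Nat.descFactorial, Nat.factorial] at this
    linarith
  rw [eq_div_iff (by norm_num)]
  exact_mod_cast h

/-- A rational polynomial which is nonnegative and linearly bounded at all large integers is
linear. -/
lemma exists_eq_linear {P : Polynomial ℚ} {A B : ℚ}
    (h0 : ∀ᶠ k : ℕ in Filter.atTop, 0 ≤ P.eval (k : ℚ))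
    (h1 : ∀ᶠ k : ℕ in Filter.atTop, P.eval (k : ℚ) ≤ A * k + B) :
    ∃ α β : ℚ, P = Polynomial.C α * Polynomial.X + Polynomial.C β := by
  have key : ∀ Q : Polynomial ℚ, 0 < Q.degree → (∀ᶠ k : ℕ in Filter.atTop, 0 ≤ Q.eval (k : ℚ)) →
      0 ≤ Q.leadingCoeff := by
    intro Q hQ h
    by_contra! hl
    have := (Q.tendsto_atBot_of_leadingCoeff_nonpos hQ hl.le).comp
      (tendsto_natCast_atTop_atTop (R := ℚ))
    obtain ⟨k, hk1, hk2⟩ := (h.and (this.eventually_lt_atBot 0)).exists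
    exact absurd hk1 (not_le.2 hk2)
  have hdeg : P.natDegree ≤ 1 := by
    by_contra! hdeg
    have hP0 : P ≠ 0 := by rintro rfl; simp at hdeg
    have hd1 : (1 : WithBot ℕ) < P.degree := by
      rw [Polynomial.degree_eq_natDegree hP0]; exact_mod_cast hdeg
    have hL : (Polynomial.C A * Polynomial.X + Polynomial.C B).degree < P.degree :=
      Polynomial.degree_linear_le.trans_lt hd1
    -- In degree above one, P and AX + B - P have opposite leading coefficients, and both would have
    -- to be nonnegative.
    have h2 := key P (zero_lt_one.trans hd1) h0
    have h3 := key (Polynomial.C A * Polynomial.X + Polynomial.C B - P)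
      (by rw [Polynomial.degree_sub_eq_right_of_degree_lt hL]; exact zero_lt_one.trans hd1)
      (by filter_upwards [h1] with k hk; simpa using hk)
    rw [Polynomial.leadingCoeff_sub_of_degree_lt' hL] at h3
    exact hP0 (Polynomial.leadingCoeff_eq_zero.1 (le_antisymm (by linarith) h2))
  exact Polynomial.exists_eq_X_add_C_of_natDegree_le_one hdeg

lemma IsHilbertPolynomial.hilbertPolynomial_eq {Q : Polynomial ℚ} (hQ : IsHilbertPolynomial f Q) :
    hilbertPolynomial f = Q := by
  have hex : ∃ P, IsHilbertPolynomial f P := ⟨_, hQ⟩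
  have hP : IsHilbertPolynomial f (hilbertPolynomial f) := by
    rw [hilbertPolynomial, dif_pos hex]
    exact hex.choose_spec
  refine polynomial_eq_of_eventually_eval_eq ?_
  filter_upwards [hP, hQ] with k h1 h2
  exact h1.trans h2.symm

/-- In the dimension count the cubic and quadratic terms of the binomials cancel, leaving (s₁² -
s₂)m + c. As dim M(f)_k ≥ 0, this bounds the Hilbert function of S/I linearly, so its Hilbert
polynomial is linear. The dimension of Σ tells which coefficient `singDegree` reads. -/
lemma IsCofactorMap.exists_linear_hilbertFn (hψ : IsCofactorMap f ρ₁ ρ₂ e₃ ψ) {d : ℕ}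
    (hf : f.IsHomogeneous d) (hd : e₁ + e₂ + e₃ + 1 = d) (h₁ : ρ₁ ∈ AR f)
    (h₂ : ρ₂ ∈ AR f) (hρ₁ : IsHomogeneousVec ρ₁ e₁) (hρ₂ : IsHomogeneousVec ρ₂ e₂)
    (hdim : singDim f = 1) {s₁ s₂ : ℚ} (hs₁ : s₁ = e₁ + e₂ + e₃)
    (hs₂ : s₂ = e₁ * e₂ + e₁ * e₃ + e₂ * e₃) :
    ∃ α β : ℚ, (∀ᶠ k : ℕ in Filter.atTop, (hilbertFn (LinearMap.range ψ) k : ℚ) = α * k + β) ∧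
      singDegree f = s₁ ^ 2 - s₂ - α := by
  obtain ⟨P, hP⟩ := eventuallyPolynomial_hilbertFn (hψ.isGradedIdeal hf)
  obtain ⟨c, hc⟩ : ∃ c : ℚ, ∀ m : ℕ,
      (hilbertFn (jacobianIdeal f) (m + 2 * (e₁ + e₂ + e₃)) : ℚ) =
        (s₁ ^ 2 - s₂) * m + c - hilbertFn (LinearMap.range ψ) (m + e₁ + e₂) := by
    let F : ℚ → ℚ := fun k => (k + 1) * (k + 2) * (k + 3) / 6
    -- F(k) is the binomial coefficient (k+3 choose 3), and c is the value at m = 0 of the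
    -- alternating sum of binomials.
    refine ⟨F (2 * (e₁ + e₂ + e₃)) + F (e₂ + e₃) + F (e₁ + e₃) + F (e₁ + e₂) -
      4 * F (e₁ + e₂ + e₃), fun m => ?_⟩
    have h := congrArg (Nat.cast : ℕ → ℚ) (hψ.hilbertFn_jacobianIdeal hf hd h₁ h₂ hρ₁ hρ₂ m)
    rw [Nat.cast_add, Nat.cast_add, Nat.cast_add, Nat.cast_add, Nat.cast_add, Nat.cast_mul,
      cast_choose_three, cast_choose_three, cast_choose_three, cast_choose_three,
      cast_choose_three] at h
    push_cast at h
    rw [hs₁, hs₂]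
    linear_combination h
  obtain ⟨α, β, rfl⟩ : ∃ α β : ℚ, P = Polynomial.C α * Polynomial.X + Polynomial.C β := by
    refine exists_eq_linear (A := s₁ ^ 2 - s₂) (B := c - (s₁ ^ 2 - s₂) * (e₁ + e₂)) ?_ ?_
    · filter_upwards [hP] with k hk
      rw [hk]
      positivity
    · filter_upwards [hP, Filter.eventually_ge_atTop (e₁ + e₂)] with k hk hk'
      obtain ⟨m, rfl⟩ := Nat.exists_eq_add_of_le' hk'
      have h := hc m
      rw [hk, ← add_assoc]
      push_cast
      have : (0 : ℚ) ≤ hilbertFn (jacobianIdeal f) (m + 2 * (e₁ + e₂ + e₃)) := by positivity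
      linarith
  refine ⟨α, β, ?_, ?_⟩
  · filter_upwards [hP] with k hk
    rw [← hk]
    simp
  · set γ : ℚ := s₁ ^ 2 - s₂ - α
    have hQ : IsHilbertPolynomial f (Polynomial.C γ * Polynomial.X +
        Polynomial.C (c - β - α * (e₁ + e₂) - γ * (2 * (e₁ + e₂ + e₃)))) := by
      obtain ⟨N, hN⟩ := Filter.eventually_atTop.1 hP
      refine Filter.eventually_atTop.2 ⟨N + 2 * (e₁ + e₂ + e₃), fun k hk => ?_⟩
      obtain ⟨m, rfl⟩ := Nat.exists_eq_add_of_le' (le_of_add_le_right hk)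
      have h := hc m
      have hN' : _ = (hilbertFn (LinearMap.range ψ) (m + e₁ + e₂) : ℚ) :=
        hN (m + e₁ + e₂) (by omega)
      rw [← hN'] at h
      change _ = (hilbertFn (jacobianIdeal f) _ : ℚ)
      rw [h]
      simp only [Polynomial.eval_add, Polynomial.eval_mul, Polynomial.eval_C, Polynomial.eval_X, γ]
      push_cast
      ring
    simp [singDegree, hdim, hQ.hilbertPolynomial_eq]

end HilbertFunctionOfSyzygies

/-! ### Binary forms and their linear factors -/

section BinaryForms

/-- The binary form `∑ n, P_n p ^ n q ^ (k - n)` attached to a polynomial `P` of degree at most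
`k`. -/
noncomputable def binaryForm (p q : S) (k : ℕ) : Polynomial ℂ →ₗ[ℂ] S where
  toFun P := ∑ n ∈ Finset.range (k + 1), P.coeff n • (p ^ n * q ^ (k - n))
  map_add' P Q := by simp [add_smul, Finset.sum_add_distrib]
  map_smul' a P := by simp [Finset.smul_sum, mul_smul]

lemma binaryForm_apply (p q : S) (k : ℕ) (P : Polynomial ℂ) :
    binaryForm p q k P = ∑ n ∈ Finset.range (k + 1), P.coeff n • (p ^ n * q ^ (k - n)) := rfl

lemma binaryForm_succ (p q : S) {k : ℕ} {P : Polynomial ℂ} (hP : P.natDegree ≤ k) :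
    binaryForm p q (k + 1) P = q * binaryForm p q k P := by
  rw [binaryForm_apply, binaryForm_apply, Finset.sum_range_succ,
    Polynomial.coeff_eq_zero_of_natDegree_lt (by omega), zero_smul, add_zero, Finset.mul_sum]
  refine Finset.sum_congr rfl fun n hn => ?_
  rw [Nat.succ_sub (by simpa [Nat.lt_succ_iff] using hn), pow_succ, mul_smul_comm]
  congr 1
  ring

lemma binaryForm_X_mul (p q : S) (k : ℕ) (P : Polynomial ℂ) :
    binaryForm p q (k + 1) (Polynomial.X * P) = p * binaryForm p q k P := by
  rw [binaryForm_apply, binaryForm_apply, Finset.sum_range_succ', Polynomial.coeff_X_mul_zero,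
    zero_smul, add_zero, Finset.mul_sum]
  refine Finset.sum_congr rfl fun n hn => ?_
  rw [Polynomial.coeff_X_mul, Nat.succ_sub_succ, pow_succ, mul_smul_comm]
  congr 1
  ring

lemma map_binaryForm (φ : S →ₐ[ℂ] S) (p q : S) (k : ℕ) (P : Polynomial ℂ) :
    φ (binaryForm p q k P) = binaryForm (φ p) (φ q) k P := by
  simp [binaryForm_apply]

lemma isHomogeneous_binaryForm (i j : Fin 4) (k : ℕ) (P : Polynomial ℂ) :
    (binaryForm (X i) (X j) k P).IsHomogeneous k := by
  rw [binaryForm_apply]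
  refine IsHomogeneous.sum _ _ _ fun n hn => ?_
  have h := (isHomogeneous_X_pow (R := ℂ) i n).mul (isHomogeneous_X_pow (R := ℂ) j (k - n))
  rw [Nat.add_sub_cancel' (by simpa [Nat.lt_succ_iff] using hn)] at h
  exact Submodule.smul_mem (Piece k) _ h

/-- `ℓ` is, up to a constant factor, an arbitrary nonzero linear form in `X i` and `X j`. -/
def IsLinearForm (i j : Fin 4) (ℓ : S) : Prop := ℓ = X j ∨ ∃ r : ℂ, ℓ = X i - C r * X j

/-- The products of units and of linear forms in `X i` and `X j`. -/
noncomputable def formProducts (i j : Fin 4) : Submonoid S :=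
  Submonoid.closure {ℓ | IsUnit ℓ ∨ IsLinearForm i j ℓ}

lemma IsLinearForm.ne_zero {i j : Fin 4} (hij : i ≠ j) {ℓ : S} (h : IsLinearForm i j ℓ) :
    ℓ ≠ 0 := by
  rcases h with rfl | ⟨r, rfl⟩
  · exact X_ne_zero _
  · intro h
    have := congrArg (eval fun s => if s = i then (1 : ℂ) else 0) h
    simp [hij.symm] at this

lemma ne_zero_of_mem_formProducts {i j : Fin 4} (hij : i ≠ j) {a : S}
    (h : a ∈ formProducts i j) : a ≠ 0 := by
  induction h using Submonoid.closure_induction with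
  | mem x hx => exact hx.elim (fun hu => hu.ne_zero) fun hl => hl.ne_zero hij
  | one => exact one_ne_zero
  | mul x y _ _ hx hy => exact mul_ne_zero hx hy

/-- Binary forms over `ℂ` are products of linear forms. -/
lemma binaryForm_mem_formProducts (i j : Fin 4) {k : ℕ} {P : Polynomial ℂ} (hP : P ≠ 0)
    (hk : P.natDegree ≤ k) : binaryForm (X i) (X j) k P ∈ formProducts i j := by
  induction k generalizing P with
  | zero =>
    obtain ⟨c, rfl⟩ := Polynomial.natDegree_eq_zero.1 (Nat.le_zero.1 hk)
    refine Submonoid.subset_closure (Or.inl ?_)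
    have hc : c ≠ 0 := by rintro rfl; simp at hP
    simpa [binaryForm_apply, smul_eq_C_mul] using (isUnit_iff_ne_zero.2 hc)
  | succ k ih =>
    -- A root r of P splits off X i - r X j; if P has degree below k + 1, the root is at infinity
    -- and X j splits off.
    rcases Nat.lt_or_ge k P.natDegree with hlt | hle
    · obtain ⟨r, hr⟩ := IsAlgClosed.exists_root P
        (by rw [Polynomial.degree_eq_natDegree hP]; exact_mod_cast (by omega : P.natDegree ≠ 0))
      obtain ⟨Q, rfl⟩ := Polynomial.dvd_iff_isRoot.2 hr
      have hQ : Q ≠ 0 := right_ne_zero_of_mul hP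
      have hQk : Q.natDegree ≤ k := by
        rw [Polynomial.natDegree_mul (Polynomial.X_sub_C_ne_zero r) hQ,
          Polynomial.natDegree_X_sub_C] at hk
        omega
      have heq : binaryForm (X i) (X j) (k + 1) ((Polynomial.X - Polynomial.C r) * Q) =
          (X i - C r * X j) * binaryForm (X i) (X j) k Q := by
        rw [sub_mul, map_sub, binaryForm_X_mul, ← Polynomial.smul_eq_C_mul, map_smul,
          binaryForm_succ _ _ hQk, smul_eq_C_mul]
        ring
      rw [heq]
      exact mul_mem (Submonoid.subset_closure (Or.inr (Or.inr ⟨r, rfl⟩))) (ih hQ hQk)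
    · rw [binaryForm_succ _ _ hle]
      exact mul_mem (Submonoid.subset_closure (Or.inr (Or.inl rfl))) (ih hP hle)

/-- If `dim (S / I)_k ≤ k`, then `I` contains a form of degree `k` in any two of the variables. -/
lemma exists_binaryForm_mem {I : Ideal S} {k : ℕ} (hI : hilbertFn I k < k + 1) (i j : Fin 4) :
    ∃ P : Polynomial ℂ, P ≠ 0 ∧ P.natDegree ≤ k ∧ binaryForm (X i) (X j) k P ∈ I := by
  let φ : Polynomial.degreeLT ℂ (k + 1) →ₗ[ℂ]
      ((Piece k).map (Ideal.Quotient.mkₐ ℂ I).toLinearMap) :=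
    LinearMap.codRestrict _ ((Ideal.Quotient.mkₐ ℂ I).toLinearMap ∘ₗ
      binaryForm (X i) (X j) k ∘ₗ (Polynomial.degreeLT ℂ (k + 1)).subtype)
      fun P => ⟨_, isHomogeneous_binaryForm i j k P, rfl⟩
  -- Binary forms of degree k span k + 1 dimensions, more than (S/I)_k has.
  have hφ : ¬ Function.Injective φ := by
    intro h
    have h1 := LinearMap.finrank_le_finrank_of_injective h
    rw [(Polynomial.degreeLTEquiv ℂ (k + 1)).finrank_eq, Module.finrank_fin_fun] at h1
    exact absurd hI (not_lt.2 h1)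
  rw [← LinearMap.ker_eq_bot, LinearMap.ker_eq_bot'] at hφ
  push Not at hφ
  obtain ⟨P, hP, hP0⟩ := hφ
  have hP0' : (P : Polynomial ℂ) ≠ 0 := fun h => hP0 (Subtype.ext h)
  refine ⟨P, hP0', ?_, ?_⟩
  · have := Polynomial.mem_degreeLT.1 P.2
    rw [Polynomial.degree_eq_natDegree hP0'] at this
    exact Nat.lt_succ_iff.1 (by exact_mod_cast this)
  · exact Ideal.Quotient.eq_zero_iff_mem.1 (congrArg Subtype.val hP)

end BinaryForms

/-! ### Saturation and reflexivity: a proper I has S/I of dimension at least two -/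

section Saturation

lemma IsLinearForm.isHomogeneous {i j : Fin 4} {ℓ : S} (h : IsLinearForm i j ℓ) :
    ℓ.IsHomogeneous 1 := by
  rcases h with rfl | ⟨r, rfl⟩
  · exact isHomogeneous_X _ _
  · exact (isHomogeneous_X _ _).sub (isHomogeneous_C_mul_X _ _)

/-- A nonunit divisor of ℓ is an associate of ℓ, so it would suffice to have ℓ ∣ m; setting the
first two variables to zero kills ℓ but fixes m ≠ 0. -/
lemma isRelPrime_of_isLinearForm {ℓ m : S} (hℓ : IsLinearForm 0 1 ℓ) (hm : IsLinearForm 2 3 m) :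
    IsRelPrime ℓ m := by
  rintro c ⟨g, hg⟩ hcm
  have hℓ0 := hℓ.ne_zero (by decide)
  have hm0 := hm.ne_zero (by decide)
  obtain ⟨a, b, hab, ha, hb⟩ := exists_isHomogeneous_of_mul (hg ▸ hℓ.isHomogeneous) (hg ▸ hℓ0)
  rcases Nat.eq_zero_or_pos a with rfl | hpos
  · exact isUnit_of_isHomogeneous_zero ha (left_ne_zero_of_mul (hg ▸ hℓ0))
  · obtain rfl : b = 0 := by omega
    have hu := isUnit_of_isHomogeneous_zero hb (right_ne_zero_of_mul (hg ▸ hℓ0))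
    have hdvd : ℓ ∣ m := by rw [hg]; exact (hu.mul_right_dvd).2 hcm
    let φ : S →ₐ[ℂ] S := aeval ![0, 0, X 2, X 3]
    have h1 : φ ℓ = 0 := by rcases hℓ with rfl | ⟨r, rfl⟩ <;> simp [φ]
    have h2 : φ m = m := by
      rcases hm with rfl | ⟨r, rfl⟩ <;> simp [φ, algebraMap_eq]
    have h3 := map_dvd φ hdvd
    rw [h1, h2] at h3
    exact absurd (zero_dvd_iff.1 h3) hm0

lemma isRelPrime_of_mem_formProducts {a b : S} (ha : a ∈ formProducts 0 1)
    (hb : b ∈ formProducts 2 3) : IsRelPrime a b := by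
  induction ha using Submonoid.closure_induction with
  | one => exact isRelPrime_one_left
  | mul x y _ _ hx hy => exact hx.mul_left hy
  | mem x hx =>
    rcases hx with hx | hx
    · exact hx.isRelPrime_left
    · induction hb using Submonoid.closure_induction with
      | one => exact isRelPrime_one_right
      | mul x y _ _ hx hy => exact hx.mul_right hy
      | mem y hy =>
        rcases hy with hy | hy
        · exact hy.isRelPrime_right
        · exact isRelPrime_of_isLinearForm hx hy

/-- The ideal `(a, b)` is saturated with respect to `I`. -/
def IsSaturatedPair (I : Ideal S) (a b : S) : Prop :=
  ∀ u, (∀ c ∈ I, c * u ∈ Ideal.span {a, b}) → u ∈ Ideal.span {a, b}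

lemma IsSaturatedPair.symm {I : Ideal S} {a b : S} (h : IsSaturatedPair I a b) :
    IsSaturatedPair I b a := by
  rwa [IsSaturatedPair, Set.pair_comm]

lemma isSaturatedPair_of_isUnit {I : Ideal S} {a b : S} (h : IsUnit a) :
    IsSaturatedPair I a b := by
  intro u _
  rw [Ideal.eq_top_of_isUnit_mem _ (Ideal.subset_span (Set.mem_insert a {b})) h]
  trivial

/-- Dévissage along 0 → S/(a₂, b) → S/(a₁a₂, b) → S/(a₁, b) → 0, where the first map is
multiplication by a₁. Coprimality makes a₁ a nonzerodivisor modulo b. -/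
lemma IsSaturatedPair.mul_left {I : Ideal S} {a₁ a₂ b : S} (h₁ : IsSaturatedPair I a₁ b)
    (h₂ : IsSaturatedPair I a₂ b) (hrel : IsRelPrime a₁ b) : IsSaturatedPair I (a₁ * a₂) b := by
  intro u hu
  have hu₁ : u ∈ Ideal.span {a₁, b} := by
    refine h₁ u fun c hc => ?_
    obtain ⟨s, t, hst⟩ := Ideal.mem_span_pair.1 (hu c hc)
    exact Ideal.mem_span_pair.2 ⟨s * a₂, t, by rw [← hst]; ring⟩
  obtain ⟨u', v, rfl⟩ := Ideal.mem_span_pair.1 hu₁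
  have hu₂ : u' ∈ Ideal.span {a₂, b} := by
    refine h₂ u' fun c hc => ?_
    obtain ⟨s, t, hst⟩ := Ideal.mem_span_pair.1 (hu c hc)
    have hdvd : b ∣ a₁ * (c * u' - s * a₂) := ⟨t - c * v, by linear_combination -hst⟩
    obtain ⟨w, hw⟩ := hrel.symm.dvd_of_dvd_mul_left hdvd
    exact Ideal.mem_span_pair.2 ⟨s, w, by linear_combination -hw⟩
  obtain ⟨s, t, rfl⟩ := Ideal.mem_span_pair.1 hu₂
  exact Ideal.mem_span_pair.2 ⟨s, t * a₁ + v, by ring⟩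

/-- Setting a linear form in `X i` and `X j` to zero leaves one of these two variables free. -/
lemma IsLinearForm.exists_subst {i j : Fin 4} {ℓ : S} (h : IsLinearForm i j ℓ) :
    ∃ (a : Fin 4) (r s : ℂ), (a = i ∧ r = 1 ∨ a = j ∧ s = 1) ∧ ℓ ∣ C r * X a - X i ∧
      ℓ ∣ C s * X a - X j ∧
      ∀ φ : S →ₐ[ℂ] S, φ (X i) = C r * X a → φ (X j) = C s * X a → φ ℓ = 0 := by
  rcases h with rfl | ⟨r, rfl⟩
  · exact ⟨i, 1, 0, Or.inl ⟨rfl, rfl⟩, by simp, by simp, fun φ _ h => by simpa using h⟩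
  · refine ⟨j, r, 1, Or.inr ⟨rfl, rfl⟩, ⟨-1, by ring⟩, by simp, fun φ h1 h2 => ?_⟩
    rw [map_sub, map_mul, h1, h2, ← algebraMap_eq, AlgHom.commutes, algebraMap_eq]
    simp

/-- S/(ℓ, m) is a polynomial ring in two remaining variables X a, X b, realised by the retraction
`φ` with kernel (ℓ, m). The ideal I contains a nonzero form in exactly these variables, and it can
be cancelled in this domain. -/
lemma isSaturatedPair_of_isLinearForm {I : Ideal S} {k : ℕ} (hI : hilbertFn I k < k + 1)
    {ℓ m : S} (hℓ : IsLinearForm 0 1 ℓ) (hm : IsLinearForm 2 3 m) : IsSaturatedPair I ℓ m := by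
  obtain ⟨a, r₀, r₁, ha, hd₀, hd₁, hφℓ⟩ := hℓ.exists_subst
  obtain ⟨b, r₂, r₃, hb, hd₂, hd₃, hφm⟩ := hm.exists_subst
  let φ : S →ₐ[ℂ] S := aeval ![C r₀ * X a, C r₁ * X a, C r₂ * X b, C r₃ * X b]
  have h0 : φ (X 0) = C r₀ * X a := by simp [φ]
  have h1 : φ (X 1) = C r₁ * X a := by simp [φ]
  have h2 : φ (X 2) = C r₂ * X b := by simp [φ]
  have h3 : φ (X 3) = C r₃ * X b := by simp [φ]
  have hmemℓ : ∀ {p}, ℓ ∣ p → p ∈ Ideal.span {ℓ, m} := fun h =>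
    Ideal.mem_of_dvd _ h (Ideal.subset_span (Set.mem_insert _ _))
  have hmemm : ∀ {p}, m ∣ p → p ∈ Ideal.span {ℓ, m} := fun h =>
    Ideal.mem_of_dvd _ h (Ideal.subset_span (Set.mem_insert_of_mem _ rfl))
  have hmod : ∀ p, φ p - p ∈ Ideal.span {ℓ, m} := by
    intro p
    rw [← Ideal.Quotient.eq_zero_iff_mem, map_sub, sub_eq_zero]
    have : (Ideal.Quotient.mkₐ ℂ (Ideal.span {ℓ, m})).comp φ =
        Ideal.Quotient.mkₐ ℂ (Ideal.span {ℓ, m}) := by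
      refine algHom_ext fun i => ?_
      rw [AlgHom.comp_apply, ← sub_eq_zero, ← map_sub]
      refine Ideal.Quotient.eq_zero_iff_mem.2 ?_
      fin_cases i
      · exact (congrArg (· - X 0) h0).symm ▸ hmemℓ hd₀
      · exact (congrArg (· - X 1) h1).symm ▸ hmemℓ hd₁
      · exact (congrArg (· - X 2) h2).symm ▸ hmemm hd₂
      · exact (congrArg (· - X 3) h3).symm ▸ hmemm hd₃
    exact DFunLike.congr_fun this p
  have hker : ∀ p, p ∈ Ideal.span {ℓ, m} ↔ φ p = 0 := by
    refine fun p => ⟨fun hp => ?_, fun hp => ?_⟩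
    · obtain ⟨s, t, rfl⟩ := Ideal.mem_span_pair.1 hp
      simp [hφℓ φ h0 h1, hφm φ h2 h3]
    · have := hmod p
      rwa [hp, zero_sub, neg_mem_iff] at this
  have hXa : φ (X a) = X a := by
    rcases ha with ⟨rfl, rfl⟩ | ⟨rfl, rfl⟩
    · simpa using h0
    · simpa using h1
  have hXb : φ (X b) = X b := by
    rcases hb with ⟨rfl, rfl⟩ | ⟨rfl, rfl⟩
    · simpa using h2
    · simpa using h3
  have hab : a ≠ b := by
    rcases ha with ⟨rfl, -⟩ | ⟨rfl, -⟩ <;> rcases hb with ⟨rfl, -⟩ | ⟨rfl, -⟩ <;> decide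
  obtain ⟨P, hP0, hPk, hPI⟩ := exists_binaryForm_mem hI a b
  have hne := ne_zero_of_mem_formProducts hab (binaryForm_mem_formProducts a b hP0 hPk)
  intro u hu
  have h := (hker _).1 (hu _ hPI)
  rw [map_mul, map_binaryForm, hXa, hXb] at h
  exact (hker u).2 ((mul_eq_zero.1 h).resolve_left hne)

lemma isSaturatedPair_of_mem_formProducts {I : Ideal S} {k : ℕ} (hI : hilbertFn I k < k + 1)
    {a b : S} (ha : a ∈ formProducts 0 1) (hb : b ∈ formProducts 2 3) :
    IsSaturatedPair I a b := by
  induction ha using Submonoid.closure_induction with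
  | one => exact isSaturatedPair_of_isUnit isUnit_one
  | mul x y hx' _ hx hy => exact hx.mul_left hy (isRelPrime_of_mem_formProducts hx' hb)
  | mem x hx =>
    rcases hx with hx | hx
    · exact isSaturatedPair_of_isUnit hx
    · induction hb using Submonoid.closure_induction with
      | one => exact (isSaturatedPair_of_isUnit isUnit_one).symm
      | mul y z hy' _ hy hz =>
        exact (hy.symm.mul_left hz.symm (isRelPrime_of_mem_formProducts
          (Submonoid.subset_closure (Or.inr hx)) hy').symm).symm
      | mem y hy =>
        rcases hy with hy | hy
        · exact (isSaturatedPair_of_isUnit hy).symm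
        · exact isSaturatedPair_of_isLinearForm hI hx hy

variable {f : S} {ρ₁ ρ₂ : Fin 4 → S} {e₃ : ℕ} {ψ : AR f →ₗ[S] S}

/-- The reflexivity of `AR(f)`: if `I = ψ(AR(f))` contains coprime `a, b` such that `(a, b)` is
saturated with respect to `I`, then `I` is the unit ideal. -/
lemma IsCofactorMap.range_eq_top_of_isSaturatedPair (hψ : IsCofactorMap f ρ₁ ρ₂ e₃ ψ)
    {a b : S} (ha : a ∈ LinearMap.range ψ) (hb : b ∈ LinearMap.range ψ) (ha0 : a ≠ 0)
    (hrel : IsRelPrime a b) (hsat : IsSaturatedPair (LinearMap.range ψ) a b) (h₁ : ρ₁ ∈ AR f)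
    (h₂ : ρ₂ ∈ AR f) : LinearMap.range ψ = ⊤ := by
  obtain ⟨ρa, rfl⟩ := ha
  obtain ⟨ρb, rfl⟩ := hb
  set a := ψ ρa
  set b := ψ ρb
  have hker : ∀ σ τ : AR f, ∃ x y : S,
      (ψ τ • (σ : Fin 4 → S) - ψ σ • (τ : Fin 4 → S)) = x • ρ₁ + y • ρ₂ := fun σ τ =>
    (hψ.eq_zero_iff (ψ τ • σ - ψ σ • τ)).1 (by simp [mul_comm])
  obtain ⟨u, v, huv⟩ := hker ρa ρb
  have huv_mem : ∀ c ∈ LinearMap.range ψ,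
      c * u ∈ Ideal.span {a, b} ∧ c * v ∈ Ideal.span {a, b} := by
    rintro _ ⟨ρc, rfl⟩
    obtain ⟨u', v', h'⟩ := hker ρa ρc
    obtain ⟨u'', v'', h''⟩ := hker ρc ρb
    -- With c = ψ(ρ_c), compare coefficients in c(bρ_a - aρ_b) = b(cρ_a - aρ_c) + a(bρ_c - cρ_b).
    have h := hψ.indep (ψ ρc * u - b * u' - a * u'') (ψ ρc * v - b * v' - a * v'') (by
      calc _ = ψ ρc • (u • ρ₁ + v • ρ₂) - b • (u' • ρ₁ + v' • ρ₂) - a • (u'' • ρ₁ + v'' • ρ₂) := by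
            module
        _ = 0 := by
            rw [← huv, ← h', ← h'']
            module)
    exact ⟨Ideal.mem_span_pair.2 ⟨u'', u', by linear_combination -h.1⟩,
      Ideal.mem_span_pair.2 ⟨v'', v', by linear_combination -h.2⟩⟩
  obtain ⟨p, q, hu⟩ := Ideal.mem_span_pair.1 (hsat u fun c hc => (huv_mem c hc).1)
  obtain ⟨p', q', hv⟩ := Ideal.mem_span_pair.1 (hsat v fun c hc => (huv_mem c hc).2)
  -- Substituting u = pa + qb and v = p'a + q'b gives b(ρ_a - qρ₁ - q'ρ₂) = a(ρ_b + pρ₁ + p'ρ₂), and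
  -- a is coprime to b.
  have hdvd : ∀ i, a ∣ (ρa : Fin 4 → S) i - q * ρ₁ i - q' * ρ₂ i := by
    intro i
    have h := congrFun huv i
    simp only [Pi.sub_apply, Pi.add_apply, Pi.smul_apply, smul_eq_mul] at h
    refine hrel.dvd_of_dvd_mul_left (y := b) ⟨(ρb : Fin 4 → S) i + p * ρ₁ i + p' * ρ₂ i, ?_⟩
    rw [← hu, ← hv] at h
    linear_combination h
  choose σ hσ using hdvd
  have hσ' : a • σ = (ρa : Fin 4 → S) - q • ρ₁ - q' • ρ₂ := funext fun i => (hσ i).symm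
  have hmem : σ ∈ AR f := by
    have h : a • σ ∈ AR f := by
      rw [hσ']
      exact sub_mem (sub_mem ρa.2 ((AR f).smul_mem _ h₁)) ((AR f).smul_mem _ h₂)
    rw [mem_AR] at h ⊢
    simp only [Pi.smul_apply, smul_eq_mul, mul_assoc, ← Finset.mul_sum] at h
    exact (mul_eq_zero.1 h).resolve_left ha0
  have hz : ψ (ρa - a • ⟨σ, hmem⟩) = 0 := by
    refine (hψ.eq_zero_iff _).2 ⟨q, q', ?_⟩
    change (ρa : Fin 4 → S) - a • σ = _
    rw [hσ']
    module
  rw [map_sub, map_smul, smul_eq_mul, sub_eq_zero] at hz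
  have h1 : ψ ⟨σ, hmem⟩ = 1 := mul_left_cancel₀ ha0 (by rw [mul_one]; exact hz.symm)
  exact (Ideal.eq_top_iff_one _).2 ⟨_, h1⟩

/-- If `I = ψ(AR(f))` is proper, then `S / I` has dimension at least two. -/
lemma IsCofactorMap.range_eq_top (hψ : IsCofactorMap f ρ₁ ρ₂ e₃ ψ) (h₁ : ρ₁ ∈ AR f)
    (h₂ : ρ₂ ∈ AR f) {k : ℕ} (hk : hilbertFn (LinearMap.range ψ) k < k + 1) :
    LinearMap.range ψ = ⊤ := by
  obtain ⟨P, hP0, hPk, hP⟩ := exists_binaryForm_mem hk 0 1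
  obtain ⟨Q, hQ0, hQk, hQ⟩ := exists_binaryForm_mem hk 2 3
  have ha := binaryForm_mem_formProducts 0 1 hP0 hPk
  have hb := binaryForm_mem_formProducts 2 3 hQ0 hQk
  exact hψ.range_eq_top_of_isSaturatedPair hP hQ (ne_zero_of_mem_formProducts (by decide) ha)
    (isRelPrime_of_mem_formProducts ha hb) (isSaturatedPair_of_mem_formProducts hk ha hb) h₁ h₂

end Saturation

/-! ### Ideals generated by two forms -/

section CompleteIntersection

lemma finrank_map_mulLeft_piece {x : S} (hx : x ≠ 0) (k : ℕ) :
    Module.finrank ℂ ((Piece k).map (LinearMap.mulLeft ℂ x)) = (k + 3).choose 3 := by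
  rw [finrank_map_mulLeft hx, finrank_piece]

/-- The Hilbert function of `S / (a, b)` for coprime forms `a, b`, from the Koszul complex. -/
lemma hilbertFn_span_pair {a b : S} {p q : ℕ} (ha : a.IsHomogeneous p) (hb : b.IsHomogeneous q)
    (ha0 : a ≠ 0) (hb0 : b ≠ 0) (hrel : IsRelPrime a b) (m : ℕ) :
    hilbertFn (Ideal.span {a, b}) (m + p + q) + (m + q + 3).choose 3 + (m + p + 3).choose 3 =
      (m + p + q + 3).choose 3 + (m + 3).choose 3 := by
  have hsup : (Piece (m + q)).map (LinearMap.mulLeft ℂ a) ⊔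
      (Piece (m + p)).map (LinearMap.mulLeft ℂ b) = idealPiece (Ideal.span {a, b}) (m + p + q) := by
    apply le_antisymm
    · refine sup_le ?_ ?_
      · rintro _ ⟨x, hx, rfl⟩
        refine ⟨Ideal.mul_mem_right _ _ (Ideal.subset_span (Set.mem_insert _ _)), ?_⟩
        have := ha.mul hx
        rwa [show p + (m + q) = m + p + q by ring] at this
      · rintro _ ⟨x, hx, rfl⟩
        refine ⟨Ideal.mul_mem_right _ _ (Ideal.subset_span (Set.mem_insert_of_mem _ rfl)), ?_⟩
        have := hb.mul hx
        rwa [show q + (m + p) = m + p + q by ring] at this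
    · rintro u ⟨hu, huh⟩
      obtain ⟨x, y, rfl⟩ := Ideal.mem_span_pair.1 hu
      rw [← homogeneousComponent_eq_self huh, map_add]
      conv in homogeneousComponent _ (x * a) => rw [add_right_comm, homogeneousComponent_mul_add ha]
      rw [homogeneousComponent_mul_add hb]
      exact Submodule.add_mem_sup
        ⟨_, homogeneousComponent_isHomogeneous (m + q) x, mul_comm _ _⟩
        ⟨_, homogeneousComponent_isHomogeneous (m + p) y, mul_comm _ _⟩
  have hinf : (Piece (m + q)).map (LinearMap.mulLeft ℂ a) ⊓
      (Piece (m + p)).map (LinearMap.mulLeft ℂ b) =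
      (Piece m).map (LinearMap.mulLeft ℂ (a * b)) := by
    ext u
    constructor
    · rintro ⟨⟨x, hx, rfl⟩, y, hy, hxy⟩
      simp only [LinearMap.mulLeft_apply] at hxy
      obtain ⟨t, rfl⟩ := hrel.symm.dvd_of_dvd_mul_left (Dvd.intro _ hxy)
      refine ⟨t, ?_, by simp only [LinearMap.mulLeft_apply]; ring⟩
      rcases eq_or_ne t 0 with rfl | ht
      · exact zero_mem _
      · obtain ⟨i, j, hij, hi, hj⟩ := exists_isHomogeneous_of_mul hx (mul_ne_zero hb0 ht)
        obtain rfl := hi.inj_right hb hb0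
        obtain rfl : j = m := by omega
        exact hj
    · rintro ⟨t, ht, rfl⟩
      refine ⟨⟨b * t, ?_, by simp⟩, a * t, ?_, by simp; ring⟩
      · have := hb.mul ht
        rwa [add_comm] at this
      · have := ha.mul ht
        rwa [add_comm] at this
  have h := Submodule.finrank_sup_add_finrank_inf_eq ((Piece (m + q)).map (LinearMap.mulLeft ℂ a))
    ((Piece (m + p)).map (LinearMap.mulLeft ℂ b))
  rw [hsup, hinf, finrank_map_mulLeft_piece ha0, finrank_map_mulLeft_piece hb0,
    finrank_map_mulLeft_piece (mul_ne_zero ha0 hb0)] at h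
  have h' := hilbertFn_add_finrank (Ideal.span {a, b}) (m + p + q)
  omega

variable {I : Ideal S} {α β : ℚ}

/-- An ideal `I` such that `S / I` has a linear Hilbert polynomial lies in no principal ideal
generated by a form of positive degree. -/
lemma not_le_span_singleton
    (hI : ∀ᶠ k : ℕ in Filter.atTop, (hilbertFn I k : ℚ) = α * k + β) {c : S} {r : ℕ}
    (hc : c.IsHomogeneous r) (hr : r ≠ 0) : ¬ I ≤ Ideal.span {c} := by
  intro hle
  -- S/I surjects onto S/(c), whose Hilbert function grows quadratically.
  have hbound : ∀ m, (m + r + 3).choose 3 ≤ hilbertFn I (m + r) + (m + 3).choose 3 := by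
    intro m
    rw [← hilbertFn_add_finrank I (m + r), ← finrank_piece m]
    have hsub : idealPiece I (m + r) ≤ (Piece m).map (LinearMap.mulLeft ℂ c) := by
      rintro u ⟨hu, huh⟩
      obtain ⟨x, rfl⟩ := Ideal.mem_span_singleton'.1 (hle hu)
      rw [← homogeneousComponent_eq_self huh, homogeneousComponent_mul_add hc]
      exact ⟨_, homogeneousComponent_isHomogeneous m x, mul_comm _ _⟩
    exact Nat.add_le_add_left
      ((Submodule.finrank_mono hsub).trans (Submodule.finrank_map_le _ _)) _
  obtain ⟨N, hN⟩ := Filter.eventually_atTop.1 hI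
  -- The linear side is at most (|α|(1 + r) + |β|)m ≤ Mm/2, while the binomial difference exceeds
  -- m²/2 and m > M.
  obtain ⟨M, hM⟩ := exists_nat_ge (2 * (|α| * (1 + r) + |β|))
  set m := N + M + 1
  have h1 : (((m + r + 3).choose 3 : ℕ) : ℚ) ≤ (hilbertFn I (m + r) : ℚ) + (m + 3).choose 3 :=
    mod_cast hbound m
  have h2 : (((m + 1 + 3).choose 3 : ℕ) : ℚ) ≤ ((m + r + 3).choose 3 : ℕ) :=
    mod_cast Nat.choose_le_choose 3 (by omega)
  rw [hN _ (by omega), cast_choose_three m] at h1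
  rw [cast_choose_three (m + 1)] at h2
  have hm : (M : ℚ) + 1 ≤ m := by simp only [m]; push_cast; linarith [(N.cast_nonneg : (0 : ℚ) ≤ N)]
  push_cast at h1 h2
  have hα := le_abs_self α
  have hβ := le_abs_self β
  have hα0 := abs_nonneg α
  have hβ0 := abs_nonneg β
  have hr0 : (0 : ℚ) ≤ r := r.cast_nonneg
  have hM0 : (0 : ℚ) ≤ M := M.cast_nonneg
  have h3 : α * (m + r) + β ≤ (|α| * (1 + r) + |β|) * m := by
    have e1 : α * (m + r) ≤ |α| * (m + r) := mul_le_mul_of_nonneg_right hα (by linarith)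
    have e2 : |α| * r ≤ |α| * r * m := le_mul_of_one_le_right (by positivity) (by linarith)
    have e3 : |β| ≤ |β| * m := le_mul_of_one_le_right hβ0 (by linarith)
    nlinarith
  nlinarith

/-- A nonunit common factor of forms that are not both zero is a form of positive degree, so the
ideal would lie in a principal one and its quotient would grow too fast. If both vanish, X 0 serves
as the principal generator. -/
lemma isRelPrime_of_linear {a b : S} {p q : ℕ} (ha : a.IsHomogeneous p) (hb : b.IsHomogeneous q)
    (hI : ∀ᶠ k : ℕ in Filter.atTop, (hilbertFn (Ideal.span {a, b}) k : ℚ) = α * k + β) :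
    IsRelPrime a b := by
  have key : ∀ {x : S} {n : ℕ}, x.IsHomogeneous n → x ≠ 0 → ∀ c, c ∣ x → c ∣ a → c ∣ b →
      IsUnit c := by
    rintro x n hx hx0 c ⟨g, rfl⟩ hca hcb
    obtain ⟨i, j, -, hi, -⟩ := exists_isHomogeneous_of_mul hx hx0
    rcases eq_or_ne i 0 with rfl | hi0
    · exact isUnit_of_isHomogeneous_zero hi (left_ne_zero_of_mul hx0)
    · refine absurd (Ideal.span_le.2 ?_) (not_le_span_singleton hI hi hi0)
      rintro u (rfl | rfl)
      · exact Ideal.mem_span_singleton.2 hca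
      · exact Ideal.mem_span_singleton.2 hcb
  intro c hca hcb
  by_cases ha0 : a = 0
  · by_cases hb0 : b = 0
    · refine absurd ?_ (not_le_span_singleton hI (isHomogeneous_X ℂ (0 : Fin 4)) one_ne_zero)
      simp [ha0, hb0]
    · exact key hb hb0 c hcb hca hcb
  · exact key ha ha0 c hca hca hcb

lemma ne_zero_of_isRelPrime_left {a b : S} (hrel : IsRelPrime a b)
    (hne : Ideal.span {a, b} ≠ ⊤) : a ≠ 0 := by
  rintro rfl
  exact hne (Ideal.eq_top_of_isUnit_mem _ (Ideal.subset_span (Set.mem_insert_of_mem _ rfl))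
    (hrel (dvd_zero b) dvd_rfl))

/-- The degree of a complete intersection of two surfaces of degrees `p` and `q` is `p * q`. -/
lemma eq_mul_of_span_pair {a b : S} {p q : ℕ} (ha : a.IsHomogeneous p) (hb : b.IsHomogeneous q)
    (hne : Ideal.span {a, b} ≠ ⊤)
    (hI : ∀ᶠ k : ℕ in Filter.atTop, (hilbertFn (Ideal.span {a, b}) k : ℚ) = α * k + β) :
    α = p * q := by
  have hrel := isRelPrime_of_linear ha hb hI
  have ha0 := ne_zero_of_isRelPrime_left hrel hne
  have hb0 := ne_zero_of_isRelPrime_left hrel.symm (by rwa [Set.pair_comm])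
  obtain ⟨N, hN⟩ := Filter.eventually_atTop.1 hI
  have key : ∀ m : ℕ, N ≤ m → α * (m + p + q) + β =
      (p * q) * m + p * q * (2 + (p + q) / 2) := by
    intro m hm
    have h := congrArg (Nat.cast : ℕ → ℚ) (hilbertFn_span_pair ha hb ha0 hb0 hrel m)
    rw [Nat.cast_add, Nat.cast_add, Nat.cast_add, hN _ (by omega), cast_choose_three,
      cast_choose_three, cast_choose_three, cast_choose_three] at h
    push_cast at h
    linear_combination h
  have h1 := key N le_rfl
  have h2 := key (N + 1) (by omega)
  push_cast at h2
  linear_combination h2 - h1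

end CompleteIntersection

/-! ### Two homogeneous generators from two arbitrary ones -/

section Nakayama

lemma exists_minimal_notMem {I J : Ideal S} (hI : IsGradedIdeal I) (h : ¬ I ≤ J) :
    ∃ (n : ℕ) (u : S), u ∈ I ∧ u.IsHomogeneous n ∧ u ∉ J ∧
      ∀ j < n, ∀ w ∈ I, w.IsHomogeneous j → w ∈ J := by
  classical
  have hex : ∃ n, ∃ u ∈ I, u.IsHomogeneous n ∧ u ∉ J := by
    by_contra! hcon
    refine h fun p hp => ?_
    rw [← sum_homogeneousComponent p]
    exact J.sum_mem fun i _ => hcon i _ (hI p hp i) (homogeneousComponent_isHomogeneous i p)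
  obtain ⟨u, hu, huh, huJ⟩ := Nat.find_spec hex
  refine ⟨_, u, hu, huh, huJ, fun j hj w hw hwh => ?_⟩
  by_contra hwJ
  exact Nat.find_min hex hj ⟨w, hw, hwh, hwJ⟩

/-- Without a constant term y raises degrees, so only components of w of degree below n contribute,
and these lie in J. -/
lemma homogeneousComponent_mul_mem {I J : Ideal S} (hI : IsGradedIdeal I) {n : ℕ}
    (hJ : ∀ j < n, ∀ w ∈ I, w.IsHomogeneous j → w ∈ J) {y w : S} (hy : constantCoeff y = 0)
    (hw : w ∈ I) : homogeneousComponent n (y * w) ∈ J := by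
  conv in y * w => rw [← sum_homogeneousComponent w, Finset.mul_sum]
  rw [map_sum]
  refine J.sum_mem fun j _ => ?_
  have hwj := homogeneousComponent_isHomogeneous (R := ℂ) j w
  rcases lt_or_ge n j with hj | hj
  · rw [homogeneousComponent_mul_of_lt hwj _ hj]
    exact zero_mem _
  · obtain ⟨i, rfl⟩ := Nat.exists_eq_add_of_le' hj
    rw [homogeneousComponent_mul_add hwj]
    rcases Nat.eq_zero_or_pos i with rfl | hi
    · rw [homogeneousComponent_zero, ← constantCoeff_eq, hy, C_0, zero_mul]
      exact zero_mem _
    · exact J.mul_mem_left _ (hJ j (by omega) _ (hI w hw j) hwj)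

/-- A proper graded ideal generated by two elements which is not contained in a principal ideal
generated by a form of positive degree is generated by two forms. -/
lemma exists_isHomogeneous_span_pair {I : Ideal S} (hI : IsGradedIdeal I) (hne : I ≠ ⊤)
    (hprin : ∀ (c : S) (r : ℕ), c.IsHomogeneous r → r ≠ 0 → ¬ I ≤ Ideal.span {c}) {g₁ g₂ : S}
    (hg : I = Ideal.span {g₁, g₂}) :
    ∃ (a b : S) (p q : ℕ), a.IsHomogeneous p ∧ b.IsHomogeneous q ∧ I = Ideal.span {a, b} := by
  -- With 𝔪 the ideal of the variables, I/𝔪I has dimension at most two, so any three elements of I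
  -- have a nontrivial ℂ-combination in 𝔪I.
  have hdep : ∀ u : Fin 3 → S, (∀ i, u i ∈ I) → ∃ c : Fin 3 → ℂ, c ≠ 0 ∧ ∃ y₁ y₂ : S,
      constantCoeff y₁ = 0 ∧ constantCoeff y₂ = 0 ∧ ∑ i, C (c i) * u i = y₁ * g₁ + y₂ * g₂ := by
    intro u hu
    have : ∀ i, ∃ x y : S, x * g₁ + y * g₂ = u i := fun i =>
      Ideal.mem_span_pair.1 (hg ▸ hu i)
    choose x y hxy using this
    let M : (Fin 3 → ℂ) →ₗ[ℂ] (Fin 2 → ℂ) := LinearMap.pi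
      ![∑ i, constantCoeff (x i) • LinearMap.proj i, ∑ i, constantCoeff (y i) • LinearMap.proj i]
    obtain ⟨c, hc, hc0⟩ := Submodule.exists_mem_ne_zero_of_ne_bot
      (LinearMap.ker_ne_bot_of_finrank_lt (f := M) (by simp))
    have h1 : ∑ i, constantCoeff (x i) * c i = 0 := by
      simpa [M] using congrFun (LinearMap.mem_ker.1 hc) 0
    have h2 : ∑ i, constantCoeff (y i) * c i = 0 := by
      simpa [M] using congrFun (LinearMap.mem_ker.1 hc) 1
    refine ⟨c, hc0, ∑ i, C (c i) * x i, ∑ i, C (c i) * y i, ?_, ?_, ?_⟩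
    · simpa [mul_comm] using h1
    · simpa [mul_comm] using h2
    · rw [Finset.sum_mul, Finset.sum_mul, ← Finset.sum_add_distrib]
      refine Finset.sum_congr rfl fun i _ => ?_
      rw [← hxy]
      ring
  have hg₁ : g₁ ∈ I := hg ▸ Ideal.subset_span (Set.mem_insert _ _)
  have hg₂ : g₂ ∈ I := hg ▸ Ideal.subset_span (Set.mem_insert_of_mem _ rfl)
  obtain ⟨p, a, ha, hah, ha0, hamin⟩ := exists_minimal_notMem (J := ⊥) hI fun h =>
    hprin _ 1 (isHomogeneous_X ℂ (0 : Fin 4)) one_ne_zero (h.trans bot_le)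
  have hp : p ≠ 0 := by
    rintro rfl
    exact hne (Ideal.eq_top_of_isUnit_mem _ ha (isUnit_of_isHomogeneous_zero hah ha0))
  obtain ⟨q, b, hb, hbh, hba, hbmin⟩ := exists_minimal_notMem hI (hprin a p hah hp)
  refine ⟨a, b, p, q, hah, hbh, ?_⟩
  by_contra hcon
  obtain ⟨n, u, hu, huh, huJ, humin⟩ := exists_minimal_notMem (J := Ideal.span {a, b}) hI
    fun h => hcon (le_antisymm h (Ideal.span_le.2 (by rintro v (rfl | rfl) <;> assumption)))
  have haJ : a ∈ Ideal.span {a, b} := Ideal.subset_span (Set.mem_insert _ _)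
  have hbJ : b ∈ Ideal.span {a, b} := Ideal.subset_span (Set.mem_insert_of_mem _ rfl)
  have haa : a ∈ Ideal.span {a} := Ideal.mem_span_singleton_self a
  -- Here a, b, u have minimal degree outside 0, (a), (a, b) respectively. Reading the relation in
  -- degrees n, q, p modulo (a, b), (a), 0 kills c 2, c 1, c 0 in turn.
  obtain ⟨c, hc0, y₁, y₂, hy₁, hy₂, hsum⟩ := hdep ![a, b, u] (by
    intro i; fin_cases i <;> assumption)
  simp only [Fin.sum_univ_three, Matrix.cons_val_zero, Matrix.cons_val_one,
    Matrix.cons_val_two, Matrix.tail_cons, Matrix.head_cons] at hsum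
  have hcomp : ∀ (m : ℕ) (J : Ideal S), (∀ j < m, ∀ w ∈ I, w.IsHomogeneous j → w ∈ J) →
      homogeneousComponent m (C (c 0) * a + C (c 1) * b + C (c 2) * u) ∈ J := by
    intro m J hJ
    rw [hsum, map_add]
    exact J.add_mem (homogeneousComponent_mul_mem hI hJ hy₁ hg₁)
      (homogeneousComponent_mul_mem hI hJ hy₂ hg₂)
  have hmem : ∀ {J : Ideal S} {v : S} {s : ℂ}, s ≠ 0 → C s * v ∈ J → v ∈ J := by
    intro J v s hs h
    have := J.mul_mem_left (C s⁻¹) h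
    rwa [← mul_assoc, ← C_mul, inv_mul_cancel₀ hs, C_1, one_mul] at this
  have hcm : ∀ {J : Ideal S} {v : S} (s : ℂ) (m : ℕ), (∃ k, v.IsHomogeneous k) → v ∈ J →
      homogeneousComponent m (C s * v) ∈ J := by
    rintro J v s m ⟨k, hk⟩ hv
    rw [homogeneousComponent_C_mul, homogeneousComponent_of_mem hk]
    split_ifs
    · exact J.mul_mem_left _ hv
    · simp
  have hc2 : c 2 = 0 := by
    by_contra h2
    have h := hcomp n _ humin
    rw [map_add, map_add, Ideal.add_mem_iff_right _ ((Ideal.span {a, b}).add_mem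
      (hcm _ _ ⟨_, hah⟩ haJ) (hcm _ _ ⟨_, hbh⟩ hbJ)), homogeneousComponent_C_mul,
      homogeneousComponent_eq_self huh] at h
    exact huJ (hmem h2 h)
  rw [hc2, C_0, zero_mul, add_zero] at hcomp
  have hc1 : c 1 = 0 := by
    by_contra h1
    have h := hcomp q _ hbmin
    rw [map_add, Ideal.add_mem_iff_right _ (hcm _ _ ⟨_, hah⟩ haa), homogeneousComponent_C_mul,
      homogeneousComponent_eq_self hbh] at h
    exact hba (hmem h1 h)
  rw [hc1, C_0, zero_mul, add_zero] at hcomp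
  have hc0' : c 0 = 0 := by
    by_contra h0
    have h := hcomp p _ hamin
    rw [homogeneousComponent_C_mul, homogeneousComponent_eq_self hah] at h
    exact ha0 (hmem h0 h)
  refine hc0 (funext fun i => ?_)
  fin_cases i <;> assumption

end Nakayama

/-! ### Freeness and near freeness in terms of I -/

section Surfaces

variable {f : S} {ρ₁ ρ₂ : Fin 4 → S} {e₁ e₂ e₃ : ℕ} {ψ : AR f →ₗ[S] S}

lemma exists_pderiv_ne_zero (hcone : 0 < mdr f) : ∃ i, pderiv i f ≠ 0 := by
  by_contra! h
  refine hcone.ne' (Nat.sInf_eq_zero.2 (Or.inl ⟨fun _ => 1, mem_AR.2 (by simp [h]), ?_,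
    fun i => isHomogeneous_one _ _⟩))
  intro h1
  exact one_ne_zero (congrFun h1 0)

lemma IsMinimalPair.pos (h : IsMinimalPair f ρ₁ ρ₂ e₁ e₂) (hcone : 0 < mdr f) : 0 < e₁ :=
  hcone.trans_le (Nat.sInf_le ⟨ρ₁, h.mem₁, h.ne_zero, h.homog₁⟩)

lemma IsMinimalPair.le (h : IsMinimalPair f ρ₁ ρ₂ e₁ e₂) : e₁ ≤ e₂ :=
  h.minimal₁ e₂ ρ₂ h.mem₂ (fun h0 => h.notMem_span (h0 ▸ zero_mem _)) h.homog₂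

/-- If the image of the cofactor map is the unit ideal, then the surface is free. -/
lemma IsCofactorMap.isFreeDivisor (hψ : IsCofactorMap f ρ₁ ρ₂ e₃ ψ) {d : ℕ}
    (hf : f.IsHomogeneous d) (hmin : IsMinimalPair f ρ₁ ρ₂ e₁ e₂) (hpos : 0 < e₁) (he : e₂ ≤ e₃)
    (htop : LinearMap.range ψ = ⊤) : IsFreeDivisor f := by
  have he₁₂ := hmin.le
  obtain ⟨τ, hτ⟩ : (1 : S) ∈ LinearMap.range ψ := htop ▸ Submodule.mem_top
  have hmem := vecComponent_mem_AR hf τ.2 (0 + e₃)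
  set σ : AR f := ⟨_, hmem⟩
  have hσ : ψ σ = 1 := by
    rw [← hψ.component τ 0 hmem, hτ]
    exact homogeneousComponent_eq_self (isHomogeneous_one _ _)
  have hσh : IsHomogeneousVec (σ : Fin 4 → S) e₃ :=
    (zero_add e₃) ▸ isHomogeneousVec_vecComponent (0 + e₃) (τ : Fin 4 → S)
  have hψ₁ : ψ ⟨ρ₁, hmin.mem₁⟩ = 0 := (hψ.eq_zero_iff _).2 ⟨1, 0, by simp⟩
  have hψ₂ : ψ ⟨ρ₂, hmin.mem₂⟩ = 0 := (hψ.eq_zero_iff _).2 ⟨0, 1, by simp⟩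
  let v : Fin 3 → AR f := ![⟨ρ₁, hmin.mem₁⟩, ⟨ρ₂, hmin.mem₂⟩, σ]
  have hli : LinearIndependent S v := by
    rw [Fintype.linearIndependent_iff]
    intro g hg
    simp only [Fin.sum_univ_three, v, Matrix.cons_val_zero, Matrix.cons_val_one,
      Matrix.cons_val] at hg
    have h2 := congrArg ψ hg
    simp only [map_add, map_smul, hψ₁, hψ₂, hσ, smul_eq_mul, mul_zero, mul_one, zero_add,
      map_zero] at h2
    rw [h2, zero_smul, add_zero] at hg
    have h01 := hψ.indep (g 0) (g 1) (congrArg Subtype.val hg)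
    intro i
    fin_cases i
    exacts [h01.1, h01.2, h2]
  have hsp : ⊤ ≤ Submodule.span S (Set.range v) := by
    rintro w -
    obtain ⟨a, b, hab⟩ := (hψ.eq_zero_iff (w - ψ w • σ)).1 (by simp [hσ])
    have hw : w = a • v 0 + b • v 1 + ψ w • v 2 := by
      refine Subtype.ext ?_
      change (w : Fin 4 → S) = a • ρ₁ + b • ρ₂ + ψ w • (σ : Fin 4 → S)
      rw [← hab]
      simp
    rw [hw]
    exact add_mem (add_mem (Submodule.smul_mem _ _ (Submodule.subset_span ⟨0, rfl⟩))
      (Submodule.smul_mem _ _ (Submodule.subset_span ⟨1, rfl⟩)))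
      (Submodule.smul_mem _ _ (Submodule.subset_span ⟨2, rfl⟩))
  refine ⟨![e₁, e₂, e₃], ?_, ?_, Module.Basis.mk hli hsp, ?_⟩
  · refine Fin.monotone_iff_le_succ.2 fun i => ?_
    fin_cases i
    exacts [he₁₂, he]
  · intro j
    fin_cases j
    exacts [hpos, hpos.trans_le he₁₂, (hpos.trans_le he₁₂).trans_le he]
  · intro j
    rw [Module.Basis.mk_apply]
    fin_cases j
    exacts [hmin.homog₁, hmin.homog₂, hσh]

/-- For a nearly free surface, the image of the cofactor map is generated by two linear forms. -/
lemma IsCofactorMap.exists_linear_span_pair (hψ : IsCofactorMap f ρ₁ ρ₂ e₃ ψ) {d : ℕ}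
    (hne : LinearMap.range ψ ≠ ⊤) (he₁₂ : e₁ ≤ e₂) (he : e₂ ≤ e₃)
    (hnf : IsNearlyFreeWith f d e₁ e₂ (e₃ + 1)) :
    ∃ a b : S, a.IsHomogeneous 1 ∧ b.IsHomogeneous 1 ∧ LinearMap.range ψ = Ideal.span {a, b} := by
  obtain ⟨-, -, -, -, σ, hσ, hspan, -⟩ := hnf
  have hmem : ∀ j, σ j ∈ AR f := fun j => hspan ▸ Submodule.subset_span ⟨j, rfl⟩
  let τ : Fin 4 → AR f := fun j => ⟨σ j, hmem j⟩
  -- In degree exactly e₃ the value is a constant, and a nonzero constant would make I the unit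
  -- ideal. This disposes of the generators of degrees e₁ and e₂.
  have hlow : ∀ (w : AR f) (q : ℕ), IsHomogeneousVec w q → q ≤ e₃ → ψ w = 0 := by
    intro w q hw hq
    rcases hq.lt_or_eq with hlt | rfl
    · exact hψ.eq_zero_of_lt w q hw hlt
    · by_contra h0
      have h := hψ.isHomogeneous (w := w) (q := 0) (by rwa [zero_add])
      exact hne (Ideal.eq_top_of_isUnit_mem _ ⟨w, rfl⟩ (isUnit_of_isHomogeneous_zero h h0))
  have h0 : ψ (τ 0) = 0 := hlow _ e₁ (hσ 0) (he₁₂.trans he)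
  have h1 : ψ (τ 1) = 0 := hlow _ e₂ (hσ 1) he
  have hspan' : Submodule.span S (Set.range τ) = ⊤ := by
    refine Submodule.map_injective_of_injective (AR f).injective_subtype ?_
    rw [Submodule.map_span, ← Set.range_comp, Submodule.map_top, Submodule.range_subtype]
    exact hspan
  refine ⟨ψ (τ 2), ψ (τ 3), hψ.isHomogeneous ?_, hψ.isHomogeneous ?_, ?_⟩
  · rw [add_comm]; exact hσ 2
  · rw [add_comm]; exact hσ 3
  · rw [LinearMap.range_eq_map, ← hspan', Submodule.map_span, ← Set.range_comp]
    apply le_antisymm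
    · refine Submodule.span_le.2 ?_
      rintro _ ⟨j, rfl⟩
      fin_cases j
      · change ψ (τ 0) ∈ Ideal.span _
        rw [h0]; exact zero_mem _
      · change ψ (τ 1) ∈ Ideal.span _
        rw [h1]; exact zero_mem _
      · exact Ideal.subset_span (Set.mem_insert _ _)
      · exact Ideal.subset_span (Set.mem_insert_of_mem _ rfl)
    · refine Submodule.span_le.2 ?_
      rintro _ (rfl | rfl)
      · exact Submodule.subset_span ⟨2, rfl⟩
      · exact Submodule.subset_span ⟨3, rfl⟩

lemma IsCofactorMap.exists_lift (hψ : IsCofactorMap f ρ₁ ρ₂ e₃ ψ) {d : ℕ}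
    (hf : f.IsHomogeneous d) {a : S} {p : ℕ} (ha : a.IsHomogeneous p)
    (hmem : a ∈ LinearMap.range ψ) :
    ∃ σ : AR f, IsHomogeneousVec (σ : Fin 4 → S) (p + e₃) ∧ ψ σ = a := by
  obtain ⟨w, rfl⟩ := hmem
  have h := vecComponent_mem_AR hf w.2 (p + e₃)
  refine ⟨⟨_, h⟩, isHomogeneousVec_vecComponent _ _, ?_⟩
  rw [← hψ.component w p h]
  exact homogeneousComponent_eq_self ha

/-- If the image of the cofactor map is generated by two coprime linear forms, then the surface
is nearly free. -/
lemma IsCofactorMap.isNearlyFreeWith (hψ : IsCofactorMap f ρ₁ ρ₂ e₃ ψ) {d : ℕ}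
    (hf : f.IsHomogeneous d) (hd : e₁ + e₂ + e₃ + 1 = d) (hmin : IsMinimalPair f ρ₁ ρ₂ e₁ e₂)
    (hpos : 0 < e₁) (he : e₂ ≤ e₃) {a b : S} (ha : a.IsHomogeneous 1) (hb : b.IsHomogeneous 1)
    (hrel : IsRelPrime a b) (hI : LinearMap.range ψ = Ideal.span {a, b}) :
    IsNearlyFreeWith f d e₁ e₂ (e₃ + 1) := by
  have he₁₂ := hmin.le
  obtain ⟨ρ₃, hρ₃, h₃⟩ := hψ.exists_lift hf ha (hI ▸ Ideal.subset_span (Set.mem_insert _ _))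
  obtain ⟨ρ₄, hρ₄, h₄⟩ := hψ.exists_lift hf hb
    (hI ▸ Ideal.subset_span (Set.mem_insert_of_mem _ rfl))
  rw [add_comm] at hρ₃ hρ₄
  have hψ₁ : ψ ⟨ρ₁, hmin.mem₁⟩ = 0 := (hψ.eq_zero_iff _).2 ⟨1, 0, by simp⟩
  have hψ₂ : ψ ⟨ρ₂, hmin.mem₂⟩ = 0 := (hψ.eq_zero_iff _).2 ⟨0, 1, by simp⟩
  have hab : ¬ a ∣ b := fun h => not_isUnit_of_isHomogeneous ha one_ne_zero (hrel dvd_rfl h)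
  have hba : ¬ b ∣ a := fun h => not_isUnit_of_isHomogeneous hb one_ne_zero (hrel h dvd_rfl)
  refine ⟨hpos, he₁₂, by omega, by omega, ![ρ₁, ρ₂, ρ₃, ρ₄], ?_, ?_, ?_⟩
  · intro j
    fin_cases j
    exacts [hmin.homog₁, hmin.homog₂, hρ₃, hρ₄]
  · apply le_antisymm
    · refine Submodule.span_le.2 ?_
      rintro _ ⟨j, rfl⟩
      fin_cases j
      exacts [hmin.mem₁, hmin.mem₂, ρ₃.2, ρ₄.2]
    · intro w hw
      obtain ⟨x, y, hxy⟩ := Ideal.mem_span_pair.1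
        (hI ▸ ⟨⟨w, hw⟩, rfl⟩ : ψ ⟨w, hw⟩ ∈ Ideal.span {a, b})
      obtain ⟨s, t, hst⟩ := (hψ.eq_zero_iff (⟨w, hw⟩ - x • ρ₃ - y • ρ₄)).1 (by
        rw [map_sub, map_sub, map_smul, map_smul, h₃, h₄, ← hxy]
        simp)
      have hw' : w = s • ρ₁ + t • ρ₂ + x • (ρ₃ : Fin 4 → S) + y • (ρ₄ : Fin 4 → S) := by
        rw [← hst]
        change w = w - x • (ρ₃ : Fin 4 → S) - y • (ρ₄ : Fin 4 → S) + _ + _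
        module
      rw [hw']
      have hj : ∀ (j : Fin 4) (c : S), c • ![ρ₁, ρ₂, (ρ₃ : Fin 4 → S), (ρ₄ : Fin 4 → S)] j ∈
          Submodule.span S (Set.range ![ρ₁, ρ₂, (ρ₃ : Fin 4 → S), (ρ₄ : Fin 4 → S)]) := fun j c =>
        Submodule.smul_mem _ _ (Submodule.subset_span ⟨j, rfl⟩)
      exact add_mem (add_mem (add_mem (hj 0 s) (hj 1 t)) (hj 2 x)) (hj 3 y)
  · have himage : ∀ (j k l m : Fin 4) (v : Fin 4 → Fin 4 → S), (∀ i, i ≠ j → i = k ∨ i = l ∨ i = m) →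
        v j ∈ Submodule.span S (v '' {j}ᶜ) →
        ∃ x y z : S, v j = x • v k + y • v l + z • v m := by
      intro j k l m v hj h
      have hle : v '' {j}ᶜ ⊆ {v k, v l, v m} := by
        rintro _ ⟨i, hi, rfl⟩
        rcases hj i hi with rfl | rfl | rfl <;> simp
      obtain ⟨x, y, z, h⟩ := Submodule.mem_span_triple.1 (Submodule.span_mono hle h)
      exact ⟨x, y, z, h.symm⟩
    have hcomp : ∀ (k : ℕ) (y z : S), k < e₃ + 1 →
        vecComponent k (y • (ρ₃ : Fin 4 → S)) + vecComponent k (z • (ρ₄ : Fin 4 → S)) = 0 := by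
      intro k y z hk
      rw [vecComponent_smul_of_lt hρ₃ _ hk, vecComponent_smul_of_lt hρ₄ _ hk, add_zero]
    -- Redundancy of ρ₁ or ρ₂ is excluded in degree e₁ or e₂, where the generators of degree e₃ + 1
    -- contribute nothing; redundancy of ρ₃ or ρ₄ would, after applying ψ, make one of a, b divide
    -- the other.
    intro j hj
    fin_cases j
    · obtain ⟨x, y, z, h⟩ := himage 0 1 2 3 _ (by decide) hj
      change ρ₁ = x • ρ₂ + y • (ρ₃ : Fin 4 → S) + z • (ρ₄ : Fin 4 → S) at h
      have h1 := congrArg (vecComponent e₁) h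
      rw [vecComponent_eq_self hmin.homog₁, add_assoc, vecComponent_add, vecComponent_add,
        hcomp _ _ _ (by omega), add_zero] at h1
      rcases he₁₂.lt_or_eq with hlt | heq
      · rw [vecComponent_smul_of_lt hmin.homog₂ _ hlt] at h1
        exact hmin.ne_zero h1
      · have h2 := vecComponent_smul hmin.homog₂ x 0
        rw [zero_add, ← heq, ← h1] at h2
        exact one_ne_zero (hψ.indep 1 (-homogeneousComponent 0 x)
          (by rw [neg_smul, ← h2, one_smul, add_neg_cancel])).1
    · obtain ⟨x, y, z, h⟩ := himage 1 0 2 3 _ (by decide) hj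
      change ρ₂ = x • ρ₁ + y • (ρ₃ : Fin 4 → S) + z • (ρ₄ : Fin 4 → S) at h
      have h1 := congrArg (vecComponent e₂) h
      rw [vecComponent_eq_self hmin.homog₂, add_assoc, vecComponent_add, vecComponent_add,
        hcomp _ _ _ (by omega), add_zero] at h1
      have h2 := vecComponent_smul hmin.homog₁ x (e₂ - e₁)
      rw [Nat.sub_add_cancel he₁₂, ← h1] at h2
      exact hmin.notMem_span (Submodule.mem_span_singleton.2 ⟨_, h2.symm⟩)
    · obtain ⟨x, y, z, h⟩ := himage 2 0 1 3 _ (by decide) hj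
      have h' : ρ₃ = x • ⟨ρ₁, hmin.mem₁⟩ + y • ⟨ρ₂, hmin.mem₂⟩ + z • ρ₄ := Subtype.ext h
      have h1 := congrArg ψ h'
      rw [map_add, map_add, map_smul, map_smul, map_smul, hψ₁, hψ₂, h₃, h₄] at h1
      exact hba ⟨z, by simpa [mul_comm] using h1⟩
    · obtain ⟨x, y, z, h⟩ := himage 3 0 1 2 _ (by decide) hj
      have h' : ρ₄ = x • ⟨ρ₁, hmin.mem₁⟩ + y • ⟨ρ₂, hmin.mem₂⟩ + z • ρ₃ := Subtype.ext h
      have h1 := congrArg ψ h'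
      rw [map_add, map_add, map_smul, map_smul, map_smul, hψ₁, hψ₂, h₃, h₄] at h1
      exact hab ⟨z, by simpa [mul_comm] using h1⟩

/-- If `ρ₁, ρ₂` and two further elements generate `AR(f)`, then the image of the cofactor map is
generated by two elements. -/
lemma IsCofactorMap.exists_span_pair (hψ : IsCofactorMap f ρ₁ ρ₂ e₃ ψ) {ρ₃ ρ₄ : Fin 4 → S}
    (hspan : Submodule.span S {ρ₁, ρ₂, ρ₃, ρ₄} = AR f) :
    ∃ g₁ g₂ : S, LinearMap.range ψ = Ideal.span {g₁, g₂} := by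
  have hmem : ∀ w ∈ ({ρ₁, ρ₂, ρ₃, ρ₄} : Set (Fin 4 → S)), w ∈ AR f := fun w hw =>
    hspan ▸ Submodule.subset_span hw
  have h₃ := hmem ρ₃ (by simp)
  have h₄ := hmem ρ₄ (by simp)
  refine ⟨ψ ⟨ρ₃, h₃⟩, ψ ⟨ρ₄, h₄⟩, le_antisymm ?_ (Submodule.span_le.2 ?_)⟩
  · rintro _ ⟨⟨w, hw⟩, rfl⟩
    have hw' := hw
    rw [← hspan, Submodule.mem_span_insert] at hw'
    obtain ⟨s, w', hw', hww'⟩ := hw'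
    obtain ⟨t, x, y, hw''⟩ := Submodule.mem_span_triple.1 hw'
    have hz := (hψ.eq_zero_iff (⟨w, hw⟩ - x • ⟨ρ₃, h₃⟩ - y • ⟨ρ₄, h₄⟩)).2 ⟨s, t, by
      change w - x • ρ₃ - y • ρ₄ = _
      rw [hww', ← hw'']
      module⟩
    rw [map_sub, map_sub, map_smul, map_smul] at hz
    refine Ideal.mem_span_pair.2 ⟨x, y, ?_⟩
    simp only [smul_eq_mul] at hz
    linear_combination -hz
  · rintro _ (rfl | rfl)
    · exact ⟨_, rfl⟩
    · exact ⟨_, rfl⟩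

end Surfaces

end ProjSurface

/-! ### The bound and its equality case -/

theorem corollary5p3
    -- a reduced surface `f = 0` of degree `d` in `ℙ³`, not a cone, with `dim Σ = 1`
    (f : ProjSurface.S) (d : ℕ) (hf : f.IsHomogeneous d) (hred : Squarefree f)
    (hcone : 0 < ProjSurface.mdr f) (hdim : ProjSurface.singDim f = 1)
    -- tame with respect to `ρ₁, ρ₂` of degrees `e₁, e₂`, with `e₃ = d - 1 - e₁ - e₂ ≥ e₂`
    (ρ₁ ρ₂ : Fin 4 → ProjSurface.S) (e₁ e₂ e₃ : ℕ)
    (htame : ProjSurface.IsTameWith f ρ₁ ρ₂ e₁ e₂)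
    (he₃ : e₁ + e₂ + e₃ + 1 = d) (he : e₂ ≤ e₃)
    (hfree : ¬ ProjSurface.IsFreeDivisor f)
    -- the elementary symmetric functions of `e₁, e₂, e₃`
    (s₁ s₂ : ℚ) (hs₁ : s₁ = e₁ + e₂ + e₃) (hs₂ : s₂ = e₁ * e₂ + e₁ * e₃ + e₂ * e₃) :
    ProjSurface.singDegree f ≤ s₁ ^ 2 - s₂ - 1 ∧
    (ProjSurface.IsNearlyFreeWith f d e₁ e₂ (e₃ + 1) →
      ProjSurface.singDegree f = s₁ ^ 2 - s₂ - 1) ∧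
    (ProjSurface.singDegree f = s₁ ^ 2 - s₂ - 1 →
      (∃ ρ₃ ρ₄ : Fin 4 → ProjSurface.S,
        Submodule.span ProjSurface.S {ρ₁, ρ₂, ρ₃, ρ₄} = ProjSurface.AR f) →
      ProjSurface.IsNearlyFreeWith f d e₁ e₂ (e₃ + 1)) := by
  obtain ⟨ψ, hψ⟩ := ProjSurface.exists_isCofactorMap hf hred
    (ProjSurface.exists_pderiv_ne_zero hcone) htame he₃
  obtain ⟨hmin, -⟩ := htame
  have hpos := hmin.pos hcone
  have hne : LinearMap.range ψ ≠ ⊤ := fun h => hfree (hψ.isFreeDivisor hf hmin hpos he h)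
  obtain ⟨α, β, hI, hdeg⟩ := hψ.exists_linear_hilbertFn hf he₃ hmin.mem₁ hmin.mem₂ hmin.homog₁
    hmin.homog₂ hdim hs₁ hs₂
  refine ⟨?_, fun hnf => ?_, fun heq ⟨ρ₃, ρ₄, hspan⟩ => ?_⟩
  · have hα : 1 ≤ α := by
      by_contra! hlt
      -- If α < 1, then αk + β < k + 1 as soon as k ≥ M > β/(1 - α), so I would be the unit ideal.
      obtain ⟨M, hM⟩ := exists_nat_gt (β / (1 - α))
      obtain ⟨k, hk, hkM⟩ := (hI.and (Filter.eventually_ge_atTop M)).exists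
      refine hne (hψ.range_eq_top hmin.mem₁ hmin.mem₂ (k := k) ?_)
      have hkM' : (M : ℚ) ≤ k := mod_cast hkM
      rw [div_lt_iff₀ (by linarith)] at hM
      have : (ProjSurface.hilbertFn (LinearMap.range ψ) k : ℚ) < k + 1 := by
        rw [hk]
        nlinarith
      exact_mod_cast this
    linarith
  · obtain ⟨a, b, ha, hb, hab⟩ := hψ.exists_linear_span_pair hne hmin.le he hnf
    have hα := ProjSurface.eq_mul_of_span_pair ha hb (hab ▸ hne) (hab ▸ hI)
    rw [hdeg, hα]
    norm_num
  · have hα : α = 1 := by linarith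
    obtain ⟨g₁, g₂, hg⟩ := hψ.exists_span_pair hspan
    obtain ⟨a, b, p, q, ha, hb, hab⟩ := ProjSurface.exists_isHomogeneous_span_pair
      (hψ.isGradedIdeal hf) hne (fun c r hc hr => ProjSurface.not_le_span_singleton hI hc hr) hg
    have hpq := ProjSurface.eq_mul_of_span_pair ha hb (hab ▸ hne) (hab ▸ hI)
    rw [hα] at hpq
    have hpq' : p * q = 1 := by exact_mod_cast hpq.symm
    obtain ⟨rfl, rfl⟩ := mul_eq_one.1 hpq'
    exact hψ.isNearlyFreeWith hf he₃ hmin hpos he ha hb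
      (ProjSurface.isRelPrime_of_linear ha hb (hab ▸ hI)) hab
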